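/- Let $\mu,p,q\ge 1$ be integers with $\gcd(p,q)=1$, and let $L=T(\mu p,\mu q)$ be the $\mu$-component torus link, presented by the standard oriented diagram of the closure of the braid $(\sigma_1\cdots\sigma_{\mu p-1})^{\mu q}$ (all strands oriented in parallel). Let $G(L)$ be the link group, given by the Wirtinger presentation of this diagram: one generator $x_i$ for each arc, one relator for each crossing. Let $\alpha_L:G(L)\to\langle t_1\rangle\oplus\cdots\oplus\langle t_\mu\rangle\cong\mathbb Z^\mu$ be the abelianization, which sends each meridian of the $k$-th component to $t_k$. Let $x,y\in G(L)$ be the classes of the cores of the two solid tori into which the torus carrying $L$ divides $S^3$, with $\alpha_L(x)=t^q$ and $\alpha_L(y)=t^p$, where $t=t_1\cdots t_\mu$; explicitly, $x$ is the product of the meridians of the overcrossing arcs of the $\mu q$ successive blocks $\sigma_1\cdots\sigma_{\mu p-1}$, and $y$ is the product of the meridians of the $\mu p$ parallel strands at the bottom of the first block. A representation $\rho:G(L)\to SL(2,\mathbb C)$ is irreducible if $\mathbb C^2$ has no nontrivial proper $\rho$-invariant subspace. Let $\mathcal X(\mu p,\mu q)$ be the set of conjugacy classes of irreducible representations, with the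 quotient of the topology of pointwise convergence. Let $l$ be the number of arcs, and let $\Phi$ be the ring homomorphism from the integral group ring of the free group on the $x_i$ to the $2\times2$ matrices over $\mathbb C[t_1^{\pm1},\dots,t_\mu^{\pm1}]$ that is induced by $g\mapsto\alpha_L(g)\rho(g)$. For any choice of $l-1$ of the Wirtinger relators $r_i$ and any generator $x_j$, Wada's twisted Alexander polynomial is $$\Delta_{L,\rho}(t_1,\dots,t_\mu)=\frac{\det A_j}{\det\Phi(x_j-1)},$$ where $A=\big(\Phi(\partial r_i/\partial x_k)\big)_{i,k}$ is the Alexander matrix formed with free derivatives, and $A_j$ is $A$ with the $j$-th column removed, regarded as a $2(l-1)\times2(l-1)$ matrix. **Theorem.** (1) For every irreducible $\rho:G(L)\to SL(2,\mathbb C)$ there are integers $0\le a\le p$ and $0\le b\le q$ with $a\equiv b\pmod 2$ such that, with $\alpha=\exp(\sqrt{-1}\,\pi a/p)$ and $\beta=\exp(\sqrt{-1}\,\pi b/q)$, the matrices $X=\rho(x)$ and $Y=\rho(y)$ are conjugate in $SL(2,\mathbb C)$ to $\mathrm{diag}(\alpha,\alpha^{-1})$ and $\mathrm{diag}(\beta,\beta^{-1})$.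 (2) Fix $l-1$ of the relators and a generator $x_j$. There are integers $k_1,\dots,k_\mu$ such that for every irreducible $\rho$ and all integers $0\le a\le p$, $0\le b\le q$ for which $\alpha=\exp(\sqrt{-1}\,\pi a/p)$ is an eigenvalue of $X$ and $\beta=\exp(\sqrt{-1}\,\pi b/q)$ is an eigenvalue of $Y$, $$\Delta_{L,\rho}(t_1,\dots,t_\mu)=t_1^{2k_1}\cdots t_\mu^{2k_\mu}\cdot\frac{\big(t^{pq}-(-1)^a\big)^{2\mu}}{(t^p-\beta)(t^p-\beta^{-1})(t^q-\alpha)(t^q-\alpha^{-1})}.$$ (3) With the same choices, $\Delta_{L,\rho}$ is a Laurent polynomial in $t_1,\dots,t_\mu$ that depends only on the conjugacy class of $\rho$, and each of its coefficients is a locally constant function on $\mathcal X(\mu p,\mu q)$. -/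

import Mathlib

open scoped Matrix

noncomputable section

/-! ### Rational functions and Laurent monomials in `t_1, …, t_μ` -/

/-- The field `ℂ(t_1, …, t_μ)`. -/
abbrev RatFn (μ : ℕ) : Type := FractionRing (MvPolynomial (Fin μ) ℂ)

/-- The variable `t_i` as a rational function. -/
def tVar {μ : ℕ} (i : Fin μ) : RatFn μ :=
  algebraMap (MvPolynomial (Fin μ) ℂ) (RatFn μ) (MvPolynomial.X i)

lemma tVar_ne_zero {μ : ℕ} (i : Fin μ) : tVar i ≠ 0 := by
  unfold tVar
  rw [Ne, IsFractionRing.to_map_eq_zero_iff]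
  exact MvPolynomial.X_ne_zero i

/-- The product `t = t_1 ⋯ t_μ`. -/
def tProd (μ : ℕ) : RatFn μ := ∏ i, tVar i

/-- The free abelian group `⟨t_1⟩ ⊕ ⋯ ⊕ ⟨t_μ⟩ ≅ ℤ^μ` inside `ℂ(t_1, …, t_μ)`: the exponent vector
`e` goes to the Laurent monomial `t_1^{e_1} ⋯ t_μ^{e_μ}`. -/
def laurentMonomial (μ : ℕ) : Multiplicative (Fin μ → ℤ) →* RatFn μ where
  toFun e := ∏ i, tVar i ^ (e.toAdd i)
  map_one' := by simp
  map_mul' e f := by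
    simp [zpow_add₀ (tVar_ne_zero _), Finset.prod_mul_distrib]

/-- The inclusion of the Laurent polynomial ring `ℂ[t_1^{±1}, …, t_μ^{±1}]` (the group algebra of
`ℤ^μ`) into the field of rational functions. -/
def laurentToRat (μ : ℕ) : AddMonoidAlgebra ℂ (Fin μ → ℤ) →ₐ[ℂ] RatFn μ :=
  AddMonoidAlgebra.lift ℂ (RatFn μ) (Fin μ → ℤ) (laurentMonomial μ)

/-! ### Free differential calculus -/

section Fox

variable {A : Type} [DecidableEq A]

/-- The matrix `(x_i, δ_{ij}; 0, 1)` over `ℤ[F]`, attached to the free generator `x_i`. -/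
def foxUnit (j i : A) : (Matrix (Fin 2) (Fin 2) (MonoidAlgebra ℤ (FreeGroup A)))ˣ where
  val := !![MonoidAlgebra.of ℤ _ (FreeGroup.of i), if i = j then 1 else 0; 0, 1]
  inv := !![MonoidAlgebra.of ℤ _ (FreeGroup.of i)⁻¹,
    -(MonoidAlgebra.of ℤ _ (FreeGroup.of i)⁻¹ * if i = j then 1 else 0); 0, 1]
  val_inv := by
    ext a b
    fin_cases a <;> fin_cases b <;>
      simp [Matrix.mul_apply, MonoidAlgebra.single_mul_single, MonoidAlgebra.one_def]
  inv_val := by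
    ext a b
    fin_cases a <;> fin_cases b <;>
      simp [Matrix.mul_apply, MonoidAlgebra.single_mul_single, MonoidAlgebra.one_def]

/-- The free differential `∂/∂x_j : F → ℤ[F]`: the upper right entry of the image of a word under
the homomorphism `x_i ↦ (x_i, δ_{ij}; 0, 1)`. By `foxDeriv_of` and `foxDeriv_mul` it is the usual
one, determined by `∂x_i/∂x_j = δ_{ij}` and `∂(uv)/∂x_j = ∂u/∂x_j + u ∂v/∂x_j`. -/
def foxDeriv (j : A) (w : FreeGroup A) : MonoidAlgebra ℤ (FreeGroup A) :=
  ((FreeGroup.lift (foxUnit j) w : (Matrix (Fin 2) (Fin 2) (MonoidAlgebra ℤ (FreeGroup A)))ˣ) :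
    Matrix (Fin 2) (Fin 2) (MonoidAlgebra ℤ (FreeGroup A))) 0 1

lemma foxLift_entries (j : A) (w : FreeGroup A) :
    ((FreeGroup.lift (foxUnit j) w).val 0 0 = MonoidAlgebra.of ℤ _ w ∧
      (FreeGroup.lift (foxUnit j) w).val 1 0 = 0) ∧
      (FreeGroup.lift (foxUnit j) w).val 1 1 = 1 := by
  induction w using FreeGroup.induction_on with
  | C1 => simp [MonoidAlgebra.one_def]
  | of i => simp [foxUnit]
  | inv_of i _ =>
    rw [map_inv, FreeGroup.lift_apply_of]
    exact ⟨⟨rfl, rfl⟩, rfl⟩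
  | mul u v hu hv =>
    simp only [map_mul, Units.val_mul, Matrix.mul_apply, Fin.sum_univ_two, hu.1.1, hu.1.2, hu.2,
      hv.1.1, hv.1.2, hv.2]
    simp

lemma foxDeriv_of (j i : A) : foxDeriv j (FreeGroup.of i) = if i = j then 1 else 0 := by
  simp [foxDeriv, foxUnit]

lemma foxDeriv_mul (j : A) (u v : FreeGroup A) :
    foxDeriv j (u * v) = foxDeriv j u + MonoidAlgebra.of ℤ _ u * foxDeriv j v := by
  simp only [foxDeriv, map_mul, Units.val_mul, Matrix.mul_apply, Fin.sum_univ_two,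
    (foxLift_entries j u).1.1, (foxLift_entries j v).2]
  rw [mul_one, add_comm]

end Fox

/-! ### Oriented link diagrams, Wirtinger presentations -/

/-- The combinatorial data of a regular projection of an oriented `μ`-component link from which the
Wirtinger presentation is read off: the finite types `A` of arcs and `C` of crossings; at every
crossing the overcrossing arc, the arc `inArc` that arrives at the underpass, the arc `outArc` that
leaves it, and the sign of the crossing; and the numbering of the components of the link. Two arcs
belong to the same component exactly when they are connected by a sequence of underpasses. -/
structure LinkDiagram (A C : Type) (μ : ℕ) where
  overArc : C → A
  inArc : C → A
  outArc : C → A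
  sign : C → ℤˣ
  component : A → Fin μ
  component_in_out : ∀ c, component (inArc c) = component (outArc c)
  connected : ∀ a b, component a = component b →
    Relation.EqvGen (fun x y => ∃ c, inArc c = x ∧ outArc c = y) a b
  component_surjective : Function.Surjective component

namespace LinkDiagram

variable {A C : Type} {μ : ℕ} (D : LinkDiagram A C μ)

/-- The Wirtinger relator `x_o^ε x_v x_o^{-ε} x_u^{-1}` of a crossing of sign `ε` with
overcrossing arc `o`, at which the arc `u` arrives at the underpass and the arc `v` leaves it. -/
def relator (c : C) : FreeGroup A :=
  FreeGroup.of (D.overArc c) ^ (D.sign c : ℤ) * FreeGroup.of (D.outArc c) *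
    (FreeGroup.of (D.overArc c) ^ (D.sign c : ℤ))⁻¹ * (FreeGroup.of (D.inArc c))⁻¹

/-- The link group `G(L)`, given by the Wirtinger presentation of the diagram. -/
abbrev linkGroup : Type := PresentedGroup (Set.range D.relator)

/-- The meridian of an arc. -/
def meridian (a : A) : D.linkGroup := PresentedGroup.of a

/-- The abelianization `α_L : G(L) → ⟨t_1⟩ ⊕ ⋯ ⊕ ⟨t_μ⟩`, which sends every meridian of the `k`-th
component to `t_k`. -/
def abelianization : D.linkGroup →* Multiplicative (Fin μ → ℤ) :=
  PresentedGroup.toGroup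
    (f := fun a => Multiplicative.ofAdd (Pi.single (D.component a) (1 : ℤ))) (by
      rintro _ ⟨c, rfl⟩
      simp only [relator, map_mul, map_inv, map_zpow, FreeGroup.lift_apply_of,
        D.component_in_out c, mul_inv_cancel_comm, mul_inv_cancel])

end LinkDiagram

/-! ### Representations and the twisted Alexander polynomial -/

/-- `SL(2, ℂ)`. -/
abbrev SL2C : Type := Matrix.SpecialLinearGroup (Fin 2) ℂ

/-- A representation is irreducible if no nontrivial proper subspace of `ℂ²` is invariant. -/
def IsIrreducibleRep {G : Type} [Group G] (ρ : G →* SL2C) : Prop :=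
  ∀ W : Submodule ℂ (Fin 2 → ℂ),
    (∀ g : G, ∀ v ∈ W, (ρ g : Matrix (Fin 2) (Fin 2) ℂ) *ᵥ v ∈ W) → W = ⊥ ∨ W = ⊤

/-- The set of irreducible representations of `G` in `SL(2, ℂ)`. -/
def IrrRep (G : Type) [Group G] : Type := {ρ : G →* SL2C // IsIrreducibleRep ρ}

/-- The topology of pointwise convergence; for finitely generated `G` it is the topology of the
matrix entries of the images of generators. -/
instance (G : Type) [Group G] : TopologicalSpace (IrrRep G) :=
  TopologicalSpace.induced (fun ρ (g : G) => ρ.1 g) inferInstance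

/-- Conjugation by elements of `SL(2, ℂ)`. -/
instance conjSetoid (G : Type) [Group G] : Setoid (IrrRep G) where
  r ρ ρ' := ∃ S : SL2C, ∀ g, ρ'.1 g = S * ρ.1 g * S⁻¹
  iseqv :=
    { refl := fun _ => ⟨1, by simp⟩
      symm := by
        rintro ρ ρ' ⟨S, h⟩
        exact ⟨S⁻¹, fun g => by rw [h g]; group⟩
      trans := by
        rintro ρ₁ ρ₂ ρ₃ ⟨S, h⟩ ⟨T, k⟩
        exact ⟨T * S, fun g => by rw [k g, h g]; group⟩ }

/-- The irreducible character variety: conjugacy classes of irreducible representations, with the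
quotient topology. -/
abbrev IrrCharVariety (G : Type) [Group G] : Type := Quotient (conjSetoid G)

namespace LinkDiagram

variable {A C : Type} {μ : ℕ} (D : LinkDiagram A C μ)

/-- The multiplicative map `g ↦ α_L(g) ρ(g)` from `G(L)` to the `2 × 2` matrices. -/
def tensorRep (ρ : D.linkGroup →* SL2C) : D.linkGroup →* Matrix (Fin 2) (Fin 2) (RatFn μ) where
  toFun g := laurentMonomial μ (D.abelianization g) •
    (ρ g : Matrix (Fin 2) (Fin 2) ℂ).map (algebraMap ℂ (RatFn μ))
  map_one' := by simp
  map_mul' g h := by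
    simp [Matrix.map_mul, smul_smul, mul_comm]

/-- The ring homomorphism `Φ`, the composition of `ℤ[F] → ℤ[G(L)]` with `ρ ⊗ α_L`. -/
def Phi (ρ : D.linkGroup →* SL2C) :
    MonoidAlgebra ℤ (FreeGroup A) →ₐ[ℤ] Matrix (Fin 2) (Fin 2) (RatFn μ) :=
  MonoidAlgebra.lift ℤ (Matrix (Fin 2) (Fin 2) (RatFn μ)) (FreeGroup A)
    ((D.tensorRep ρ).comp (PresentedGroup.mk (Set.range D.relator)))

variable [Fintype A] [DecidableEq A]

/-- The Alexander matrix with the column of the generator `j` removed, regarded as a square matrix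
of size `2(l-1)`, where `l` is the number of arcs. The injection `r` lists the `l-1` relators of the
presentation; its index set is that of the remaining columns. -/
def alexanderMatrix (ρ : D.linkGroup →* SL2C) (j : A) (r : {i : A // i ≠ j} ↪ C) :
    Matrix ({i : A // i ≠ j} × Fin 2) ({i : A // i ≠ j} × Fin 2) (RatFn μ) :=
  Matrix.of fun u v => D.Phi ρ (foxDeriv v.1.1 (D.relator (r u.1))) u.2 v.2

/-- Wada's twisted Alexander polynomial `det A_j / det Φ(x_j - 1)`, computed from the Wirtinger
presentation whose generators are the arcs and whose `l-1` relators are those listed by `r`. -/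
def twistedAlexander (ρ : D.linkGroup →* SL2C) (j : A) (r : {i : A // i ≠ j} ↪ C) : RatFn μ :=
  (D.alexanderMatrix ρ j r).det / (D.Phi ρ (MonoidAlgebra.of ℤ _ (FreeGroup.of j) - 1)).det

end LinkDiagram

/-! ### The standard diagram of a torus link

The torus link `T(n, m)` is the closure of the `n`-strand braid `(σ_1 ⋯ σ_{n-1})^m`. The diagram
consists of `m` blocks `σ_1 ⋯ σ_{n-1}`, numbered cyclically. All strands run upwards; at the bottom
of a block the strands have the positions `0, …, n-1` from left to right. In each block the strand
at position `0` passes over all the others to position `n-1`, and the strand at position `i + 1`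
passes under it to position `i`. All crossings are positive. -/

/-- The arcs of the diagram. For `2 ≤ n` an arc is named by the place where it begins: `(k, i)` with
`i + 1 < n` is the arc that begins by arriving at position `i` at the bottom of block `k`. For
`n = 1` there are no crossings, and the only arc is a whole circle, which is named `(0, 0)`. -/
abbrev TorusArc (n m : ℕ) [NeZero m] : Type :=
  {a : Fin m × Fin n // (a.2 : ℕ) + 1 < n ∨ (n = 1 ∧ a.1 = 0)}

/-- The crossings: `(k, i)` is the one in block `k` at which the strand at position `i + 1`
passes under. -/
abbrev TorusCrossing (n m : ℕ) : Type := {c : Fin m × Fin n // (c.2 : ℕ) + 1 < n}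

/-- The arc which is at position `i` at the bottom of block `k`. At position `n - 1` (for `2 ≤ n`)
this is the overcrossing arc of the preceding block. -/
def torusStrand (n m : ℕ) [NeZero n] [NeZero m] (k : Fin m) (i : Fin n) : TorusArc n m :=
  if h : (i : ℕ) + 1 < n then ⟨(k, i), Or.inl h⟩
  else if h1 : n = 1 then ⟨(0, 0), Or.inr ⟨h1, rfl⟩⟩
  else ⟨(k - 1, 0), Or.inl (by
    have := NeZero.pos n
    simp only [Fin.val_zero]
    omega)⟩

lemma torus_component_succ {μ q : ℕ} [NeZero μ] [NeZero q] (k : Fin (μ * q)) :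
    ((k + 1 : Fin (μ * q)) : ℕ) % μ = ((k : ℕ) + 1) % μ := by
  rw [Fin.val_add, Nat.mod_mul_right_mod, Nat.add_mod, Fin.val_one', Nat.mod_mul_right_mod,
    ← Nat.add_mod]

lemma torus_component_pred {μ q : ℕ} [NeZero μ] [NeZero q] (k : Fin (μ * q)) :
    (((k - 1 : Fin (μ * q)) : ℕ) + 1) % μ = (k : ℕ) % μ := by
  rw [← torus_component_succ, sub_add_cancel]

/-- The component of the torus link to which an arc belongs: the arc at position `i` at the bottom
of block `k` belongs to the component `k + i` modulo `μ`. -/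
def torusComponent (μ p q : ℕ) [NeZero μ] [NeZero q] (a : TorusArc (μ * p) (μ * q)) : Fin μ :=
  ⟨((a.1.1 : ℕ) + (a.1.2 : ℕ)) % μ, Nat.mod_lt _ (NeZero.pos μ)⟩

lemma torusComponent_strand (μ p q : ℕ) [NeZero μ] [NeZero p] [NeZero q] (k : Fin (μ * q))
    (i : Fin (μ * p)) :
    (torusComponent μ p q (torusStrand (μ * p) (μ * q) k i) : ℕ) = ((k : ℕ) + i) % μ := by
  unfold torusStrand torusComponent
  split_ifs with h h1
  · rfl
  · obtain rfl := Nat.eq_one_of_mul_eq_one_right h1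
    simp [Nat.mod_one]
  · have hi : (i : ℕ) + 1 = μ * p := by have := i.2; omega
    have h2 := torus_component_pred k
    have h3 : ((k : ℕ) + i + 1) % μ = (((k - 1 : Fin (μ * q)) : ℕ) + 1) % μ := by
      rw [h2, add_assoc, hi, Nat.add_mul_mod_self_left]
    simp only [Fin.val_zero, add_zero]
    exact (Nat.ModEq.add_right_cancel' 1 h3).symm

lemma torus_connected (μ p q : ℕ) [NeZero μ] [NeZero p] [NeZero q] (hpq : p.Coprime q)
    (a b : TorusArc (μ * p) (μ * q)) (h : torusComponent μ p q a = torusComponent μ p q b) :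
    Relation.EqvGen (fun x y => ∃ c : TorusCrossing (μ * p) (μ * q),
      torusStrand (μ * p) (μ * q) c.1.1 (c.1.2 + 1) = x ∧
        torusStrand (μ * p) (μ * q) (c.1.1 + 1) c.1.2 = y) a b := by
  obtain ⟨⟨k, i⟩, ha⟩ := a
  obtain ⟨⟨l, j⟩, hb⟩ := b
  have hn : 0 < μ * p := NeZero.pos _
  by_cases h1 : μ * p = 1
  · have hk : k = 0 := by
      rcases ha with ha | ha
      · simp only at ha; omega
      · exact ha.2
    have hl : l = 0 := by
      rcases hb with hb | hb
      · simp only at hb; omega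
      · exact hb.2
    have hij : i = j := by apply Fin.ext; have := i.2; have := j.2; omega
    subst hk hl hij
    exact Relation.EqvGen.refl _
  set r := fun x y => ∃ c : TorusCrossing (μ * p) (μ * q),
      torusStrand (μ * p) (μ * q) c.1.1 (c.1.2 + 1) = x ∧
        torusStrand (μ * p) (μ * q) (c.1.1 + 1) c.1.2 = y with hr
  let G : ℕ → TorusArc (μ * p) (μ * q) :=
    fun x => torusStrand (μ * p) (μ * q) (Fin.ofNat (μ * q) x) 0
  have ofNat_succ : ∀ x : ℕ, Fin.ofNat (μ * q) (x + 1) = Fin.ofNat (μ * q) x + 1 := by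
    intro x
    apply Fin.ext
    simp [Fin.val_add, Nat.add_mod]
  -- following a strand to the block in which it passes over
  have hA : ∀ (i : ℕ) (hi : i < μ * p) (x : ℕ),
      Relation.EqvGen r (torusStrand (μ * p) (μ * q) (Fin.ofNat (μ * q) x) ⟨i, hi⟩) (G (x + i)) := by
    intro i
    induction i with
    | zero => intro hi x; exact Relation.EqvGen.refl _
    | succ i ih =>
      intro hi x
      refine Relation.EqvGen.trans _ _ _ ?_
        (by have := ih (by omega) (x + 1); rwa [add_assoc, add_comm 1 i] at this)
      refine Relation.EqvGen.rel _ _ ⟨⟨(Fin.ofNat (μ * q) x, ⟨i, by omega⟩), hi⟩, ?_, ?_⟩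
      · congr 1
        apply Fin.ext
        have : 1 % (μ * p) = 1 := Nat.mod_eq_of_lt (by omega)
        simp only [Fin.val_add, Fin.val_one', this]
        exact Nat.mod_eq_of_lt hi
      · rw [ofNat_succ]
  have hB : ∀ x, Relation.EqvGen r (G x) (G (x + μ * p)) := by
    intro x
    have h2 := hA (μ * p - 1) (by omega) (x + 1)
    have h3 : torusStrand (μ * p) (μ * q) (Fin.ofNat (μ * q) (x + 1)) ⟨μ * p - 1, by omega⟩
        = G x := by
      have h4 : ¬ (μ * p - 1 + 1 < μ * p) := by omega
      have h5 : (0 : Fin (μ * p)).val + 1 < μ * p := by simp only [Fin.val_zero]; omega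
      simp only [G, torusStrand, ofNat_succ, h4, h1, h5, dif_pos, dif_neg, not_false_eq_true,
        add_sub_cancel_right]
    rw [h3] at h2
    convert h2 using 2
    omega
  have hC : ∀ (d x : ℕ), Relation.EqvGen r (G x) (G (x + μ * p * d)) := by
    intro d
    induction d with
    | zero => intro x; exact Relation.EqvGen.refl _
    | succ d ih =>
      intro x
      refine Relation.EqvGen.trans _ _ _ (ih x) ?_
      have := hB (x + μ * p * d)
      rwa [add_assoc, ← Nat.mul_succ] at this
  have hD : ∀ x y, x ≤ y → x % μ = y % μ → Relation.EqvGen r (G x) (G y) := by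
    intro x y hxy hmod
    obtain ⟨d, hd⟩ := (Nat.modEq_iff_dvd' hxy).mp hmod
    obtain ⟨u, hu⟩ := Nat.exists_mul_mod_eq_of_coprime d hpq (NeZero.ne q)
    have h2 : G (x + μ * p * u) = G y := by
      have h3 : Fin.ofNat (μ * q) (x + μ * p * u) = Fin.ofNat (μ * q) y := by
        apply Fin.ext
        have h4 : y = x + μ * d := by omega
        have h5 : μ * (p * u) ≡ μ * d [MOD μ * q] := Nat.ModEq.mul_left' μ hu.2
        simp only [Fin.ofNat, h4, mul_assoc]
        exact Nat.ModEq.add_left x h5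
      simp only [G, h3]
    rw [← h2]
    exact hC u x
  have hE : ∀ x y, x % μ = y % μ → Relation.EqvGen r (G x) (G y) := by
    intro x y hxy
    rcases le_total x y with h2 | h2
    · exact hD x y h2 hxy
    · exact (hD y x h2 hxy.symm).symm
  have hF : ∀ (k : Fin (μ * q)) (i : Fin (μ * p)) (ha),
      Relation.EqvGen r ⟨(k, i), ha⟩ (G (k + i)) := by
    intro k i ha
    have hi : (i : ℕ) + 1 < μ * p := by
      rcases ha with ha | ha
      · exact ha
      · exact absurd ha.1 h1
    have h2 := hA i i.2 k
    have h3 : torusStrand (μ * p) (μ * q) (Fin.ofNat (μ * q) k) ⟨i, i.2⟩ = ⟨(k, i), ha⟩ := by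
      simp [torusStrand, hi]
    rwa [h3] at h2
  exact Relation.EqvGen.trans _ _ _ (hF k i ha) (Relation.EqvGen.trans _ _ _
    (hE _ _ (congrArg Fin.val h)) (hF l j hb).symm)

/-- The standard diagram of the `μ`-component torus link `T(μp, μq)`. -/
def torusLinkDiagram (μ p q : ℕ) [NeZero μ] [NeZero p] [NeZero q] (hpq : p.Coprime q) :
    LinkDiagram (TorusArc (μ * p) (μ * q)) (TorusCrossing (μ * p) (μ * q)) μ where
  overArc c := torusStrand (μ * p) (μ * q) c.1.1 0
  inArc c := torusStrand (μ * p) (μ * q) c.1.1 (c.1.2 + 1)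
  outArc c := torusStrand (μ * p) (μ * q) (c.1.1 + 1) c.1.2
  sign _ := 1
  component := torusComponent μ p q
  component_in_out c := by
    apply Fin.ext
    have h : ((c.1.2 + 1 : Fin (μ * p)) : ℕ) = c.1.2 + 1 := by
      have h2 := c.2
      have : 1 % (μ * p) = 1 := Nat.mod_eq_of_lt (by omega)
      rw [Fin.val_add, Fin.val_one', this, Nat.mod_eq_of_lt h2]
    rw [torusComponent_strand, torusComponent_strand, h, Nat.add_mod ((c.1.1 + 1 : Fin _) : ℕ),
      torus_component_succ, ← Nat.add_mod, add_assoc, add_comm 1]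
  connected := torus_connected μ p q hpq
  component_surjective i := by
    have hi : (i : ℕ) < μ * q := lt_of_lt_of_le i.2 (Nat.le_mul_of_pos_right μ (NeZero.pos q))
    refine ⟨torusStrand (μ * p) (μ * q) ⟨i, hi⟩ 0, ?_⟩
    apply Fin.ext
    rw [torusComponent_strand]
    simp [Nat.mod_eq_of_lt i.2]

/-- The class `x` in the link group of the core of the solid torus that contains the closed braid:
a loop which runs upwards once around the closed braid and passes, in every block, under the
overcrossing strand and over all the other ones. It is the product of the meridians of the
overcrossing arcs of the blocks `0, 1, …, μq - 1`, in this order. -/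
def torusCoreX (μ p q : ℕ) [NeZero μ] [NeZero p] [NeZero q] (hpq : p.Coprime q) :
    (torusLinkDiagram μ p q hpq).linkGroup :=
  (List.ofFn fun k : Fin (μ * q) =>
    (torusLinkDiagram μ p q hpq).meridian (torusStrand (μ * p) (μ * q) k 0)).prod

/-- The class `y` in the link group of the core of the complementary solid torus: a loop which
passes from right to left under all the strands at the bottom of block `0`. It is the product of
the meridians of these strands, from the last position to the first. -/
def torusCoreY (μ p q : ℕ) [NeZero μ] [NeZero p] [NeZero q] (hpq : p.Coprime q) :
    (torusLinkDiagram μ p q hpq).linkGroup :=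
  (List.ofFn fun i : Fin (μ * p) =>
    (torusLinkDiagram μ p q hpq).meridian (torusStrand (μ * p) (μ * q) 0 i.rev)).prod

/-- `exp(iπa/p)`. -/
def rootExp (a p : ℕ) : ℂ := Complex.exp (Complex.I * Real.pi * a / p)

end

/-!
Let `n = μp` and `m = μq`, and let `g_k` (`k` modulo `m`) be the meridian of the overcrossing arc of
block `k`. The Wirtinger relations express all other meridians by the `g_k`, and what remains of them
says that the product `g_k ⋯ g_{k+n-1}` does not depend on `k` (`IsTorusFamily.cycProd_eq`). This
product is the core `y`, the product of `m` successive `g_k` is the core `x`, and counting factors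
gives `x ^ p = y ^ q`, a central element.

By Schur's lemma an irreducible representation sends this element to a scalar matrix, which is `±1`
as its determinant is one. So `X` and `Y` have finite order, hence are diagonalizable, and their
eigenvalues are roots of unity with `α ^ p = β ^ q`; this is the first part
(`exists_core_conj`).

For the second part, the Alexander matrix is regarded as an operator on derivations. Eliminating the
arcs that are not named `(k, 0)` has determinant one (`det_eliminateMap`), and turns the remaining
rows into differences of successive rows of the operator `1 + T + ⋯ + T ^ (n - 1)`, where
`(T d) k = Φ(g_k) (d (k + 1))` is a weighted cyclic shift (`relatorRow_last`); the rows of this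
operator are the values of a derivation at the core `y`. Putting such a row in the place of the
omitted relator (`det_coreRow_replace`), and comparing with the matrix from which the column
`j` is removed by means of the right null vector `x_a - 1` (`det_addRow_mul_det`), one finds
`Δ * det Φ(y - 1) = det Φ(g) * det (1 + T + ⋯ + T ^ (n - 1))` for an element `g` of the link group
that depends on the omitted relator only. Now `det (T - 1) = det Φ(x - 1)`
(`det_cycShift_sub_one`), and `T ^ n` is the shift by `n` places composed with `Φ(y)`, which splits
into `μ` cycles of length `q`, so that `det (T ^ n - 1)` is the determinant of the scalar
`Φ(y ^ q) - 1 = (-1) ^ a t ^ (pq) - 1` on a space of dimension `2μ` (`det_shift_sub_one`). Signs of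
permutations disappear because the representation has even dimension, and `det Φ(g)` is the square
of a Laurent monomial because `ρ` has determinant one.

For the third part, the quotient is a Laurent polynomial since the denominator divides the numerator
(`denominator_dvd`); for knots this uses that neither core has a scalar image
(`core_ne_smul_one`). The polynomial is determined by the traces of `X` and `Y`, which are continuous
functions on the character variety with finitely many values (`isLocallyConstant_coreTraces`).
-/

noncomputable section

/-! ### Determinants of operators on `V ^ ι` -/

section LinAlg

theorem restrict_single {V ι : Type*} [Zero V] [DecidableEq ι] {p : ι → Prop} (j : ι) (hj : p j) (v : V) :
    (fun a : {i // p i} => (Pi.single j v : ι → V) a) = Pi.single ⟨j, hj⟩ v := by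
  funext ⟨k, hk⟩
  by_cases hkj : k = j
  · subst hkj; simp
  · rw [Pi.single_eq_of_ne hkj, Pi.single_eq_of_ne (by simpa using hkj)]

variable {K V ι : Type*} [Field K] [AddCommGroup V] [Module K V] [FiniteDimensional K V]
  [Fintype ι]

/-- The determinant of a block triangular operator on `V ^ ι`: the output at the indices that satisfy
`p` depends on the input at these indices only. -/
theorem det_eq_of_block (p : ι → Prop) [DecidablePred p]
    (L : (ι → V) →ₗ[K] (ι → V)) (L₁ : ({i // p i} → V) →ₗ[K] ({i // p i} → V))
    (L₂ : ({i // ¬ p i} → V) →ₗ[K] ({i // ¬ p i} → V))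
    (h₁ : ∀ δ i (hi : p i), L δ i = L₁ (fun a => δ a) ⟨i, hi⟩)
    (h₂ : ∀ δ, (∀ i, p i → δ i = 0) → ∀ i (hi : ¬ p i), L δ i = L₂ (fun a => δ a) ⟨i, hi⟩) :
    LinearMap.det L = LinearMap.det L₁ * LinearMap.det L₂ := by
  classical
  let b := Module.finBasis K V
  let B := Pi.basis (fun _ : ι => b)
  let B₁ := Pi.basis (fun _ : {i // p i} => b)
  let B₂ := Pi.basis (fun _ : {i // ¬ p i} => b)
  rw [← LinearMap.det_toMatrix B, ← LinearMap.det_toMatrix B₁, ← LinearMap.det_toMatrix B₂,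
    Matrix.twoBlockTriangular_det' _ (fun x => p x.1)]
  · congr 1
    · let e : {x : Σ _ : ι, Fin (Module.finrank K V) // p x.1} ≃
          Σ _ : {i // p i}, Fin (Module.finrank K V) :=
        ⟨fun x => ⟨⟨x.1.1, x.2⟩, x.1.2⟩, fun x => ⟨⟨x.1.1, x.2⟩, x.1.2⟩, fun _ => rfl, fun _ => rfl⟩
      rw [← Matrix.det_submatrix_equiv_self e]
      congr 1
      ext ⟨⟨i, a⟩, hi⟩ ⟨⟨j, c⟩, hj⟩
      simp only [Matrix.toSquareBlockProp_def, Matrix.of_apply, Matrix.submatrix_apply,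
        LinearMap.toMatrix_apply, B, B₁, Pi.basis_repr, Pi.basis_apply, h₁ _ _ hi, e,
        Equiv.coe_fn_mk]
      rw [restrict_single j hj]
    · let e : {x : Σ _ : ι, Fin (Module.finrank K V) // ¬ p x.1} ≃
          Σ _ : {i // ¬ p i}, Fin (Module.finrank K V) :=
        ⟨fun x => ⟨⟨x.1.1, x.2⟩, x.1.2⟩, fun x => ⟨⟨x.1.1, x.2⟩, x.1.2⟩, fun _ => rfl, fun _ => rfl⟩
      rw [← Matrix.det_submatrix_equiv_self e]
      congr 1
      ext ⟨⟨i, a⟩, hi⟩ ⟨⟨j, c⟩, hj⟩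
      simp only [Matrix.toSquareBlockProp_def, Matrix.of_apply, Matrix.submatrix_apply,
        LinearMap.toMatrix_apply, B, B₂, Pi.basis_repr, Pi.basis_apply, e,
        Equiv.coe_fn_mk]
      rw [h₂ _ (fun k hk => Pi.single_eq_of_ne (by rintro rfl; exact hj hk) _) i hi]
      rw [restrict_single j hj]
  · rintro ⟨i, a⟩ hi ⟨j, c⟩ hj
    simp only [LinearMap.toMatrix_apply, B, Pi.basis_repr, Pi.basis_apply, h₁ _ _ hi]
    have : (fun a : {i // p i} => (Pi.single j (b c) : ι → V) a) = 0 := by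
      ext ⟨k, hk⟩
      exact Pi.single_eq_of_ne (by rintro rfl; exact hj hk) _
    rw [this]; simp

/-- The determinant of a triangular operator on `V ^ ι`, with respect to a ranking `f` of the indices
that may have ties: the output at `i` is `c i` applied to the input at `i`, up to terms that
depend on the input at indices of lower rank. -/
theorem det_eq_of_triangular (f : ι → ℕ) (L : (ι → V) →ₗ[K] (ι → V)) (c : ι → Module.End K V)
    (h : ∀ i δ, (∀ j, f j < f i → δ j = 0) → L δ i = c i (δ i)) :
    LinearMap.det L = ∏ i, LinearMap.det (c i) := by
  classical
  let b := Module.finBasis K V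
  let B := Pi.basis (fun _ : ι => b)
  -- break the ties of `f`, and reverse the order to match `Matrix.BlockTriangular`
  let w : ι → (ℕ ×ₗ Fin (Fintype.card ι))ᵒᵈ :=
    fun i => OrderDual.toDual (toLex (f i, Fintype.equivFin ι i))
  have hw : Function.Injective w := by
    intro i j hij
    have h1 := congrArg (fun z => (ofLex (OrderDual.ofDual z)).2) hij
    exact (Fintype.equivFin ι).injective h1
  rw [← LinearMap.det_toMatrix B]
  let : LinearOrder ι := LinearOrder.lift' w hw
  have hT : (LinearMap.toMatrix B B L).BlockTriangular Sigma.fst := by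
    rintro ⟨i, a⟩ ⟨j, d⟩ hij
    have hij' : toLex (f i, Fintype.equivFin ι i) < toLex (f j, Fintype.equivFin ι j) := hij
    rw [Prod.Lex.toLex_lt_toLex] at hij'
    have hne : i ≠ j := by rintro rfl; exact lt_irrefl _ hij
    have hle : f i ≤ f j := by rcases hij' with h' | h' <;> [exact h'.le; exact h'.1.le]
    simp only [LinearMap.toMatrix_apply, B, Pi.basis_repr, Pi.basis_apply]
    rw [h, Pi.single_eq_of_ne hne]
    · simp
    · intro k hk
      exact Pi.single_eq_of_ne (by rintro rfl; omega) _
  refine (Eq.trans (by congr!) hT.det_fintype).trans ?_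
  refine Finset.prod_congr rfl fun i _ => ?_
  rw [← LinearMap.det_toMatrix b]
  let e : {x : Σ _ : ι, Fin (Module.finrank K V) // x.1 = i} ≃ Fin (Module.finrank K V) :=
    ⟨fun x => x.1.2, fun a => ⟨⟨i, a⟩, rfl⟩, fun ⟨⟨_, _⟩, h⟩ => by cases h; rfl, fun _ => rfl⟩
  rw [← Matrix.det_submatrix_equiv_self e]
  congr 1
  ext ⟨⟨i', a⟩, hi⟩ ⟨⟨j, d⟩, hj⟩
  cases hi
  cases hj
  simp only [Matrix.toSquareBlock_def, Matrix.of_apply, Matrix.submatrix_apply,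
    LinearMap.toMatrix_apply, B, Pi.basis_repr, Pi.basis_apply, e, Equiv.coe_fn_mk]
  rw [h, Pi.single_eq_same]
  intro k hk
  exact Pi.single_eq_of_ne (by rintro rfl; omega) _

/-- A permutation of the summands of `V ^ ι` has determinant `sign ^ dim V`. This is why no
signs occur in this file. -/
theorem det_funLeft_perm (hV : Even (Module.finrank K V)) (σ : Equiv.Perm ι) :
    LinearMap.det (LinearMap.funLeft K V σ) = 1 := by
  classical
  induction σ using Equiv.Perm.swap_induction_on with
  | one => 
    have : LinearMap.funLeft K V ((1 : Equiv.Perm ι) : ι → ι) = LinearMap.id := by ext; simp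
    rw [this, LinearMap.det_id]
  | swap_mul σ x y hxy ih =>
    have : LinearMap.funLeft K V ((Equiv.swap x y * σ : Equiv.Perm ι) : ι → ι) =
      LinearMap.funLeft K V σ ∘ₗ LinearMap.funLeft K V (Equiv.swap x y) := by
      rw [← LinearMap.funLeft_comp]; rfl
    rw [this, LinearMap.det_comp, ih, one_mul]
    -- in coordinates a transposition on `V ^ ι` is a sum of `dim V` transpositions on `K ^ ι`
    have hsq : LinearMap.det (LinearMap.funLeft K K (Equiv.swap x y)) *
        LinearMap.det (LinearMap.funLeft K K (Equiv.swap x y)) = 1 := by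
      rw [← LinearMap.det_comp, ← LinearMap.funLeft_comp, ← Equiv.Perm.coe_mul, Equiv.swap_mul_self]
      have : LinearMap.funLeft K K ((1 : Equiv.Perm ι) : ι → ι) = LinearMap.id := by ext; simp
      rw [this, LinearMap.det_id]
    let b := Module.finBasis K V
    let e : (ι → V) ≃ₗ[K] (Fin (Module.finrank K V) → ι → K) :=
      { toFun δ a i := b.equivFun (δ i) a
        invFun φ i := b.equivFun.symm (fun a => φ a i)
        map_add' _ _ := by ext; simp
        map_smul' _ _ := by ext; simp
        left_inv δ := by funext i; exact b.equivFun.symm_apply_apply (δ i)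
        right_inv φ := by funext a i; exact congrFun (b.equivFun.apply_symm_apply _) a }
    rw [← LinearMap.det_conj _ e]
    have : (e : (ι → V) →ₗ[K] (Fin (Module.finrank K V) → ι → K)) ∘ₗ
        LinearMap.funLeft K V (Equiv.swap x y) ∘ₗ (e.symm : _ →ₗ[K] (ι → V)) =
        LinearMap.pi fun i => (LinearMap.funLeft K K (Equiv.swap x y)).comp (LinearMap.proj i) := by
      refine LinearMap.ext fun φ => ?_
      funext a i
      exact congrFun (b.equivFun.apply_symm_apply _) a
    rw [this, LinearMap.det_pi, Finset.prod_const, Finset.card_univ, Fintype.card_fin]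
    obtain ⟨k, hk⟩ := hV
    rw [hk, pow_add, ← mul_pow, hsq, one_pow]

theorem det_comp_funLeft (hV : Even (Module.finrank K V)) (σ : Equiv.Perm ι)
    (L : (ι → V) →ₗ[K] (ι → V)) :
    LinearMap.det (LinearMap.funLeft K V σ ∘ₗ L) = LinearMap.det L := by
  rw [LinearMap.det_comp, det_funLeft_perm hV, one_mul]

end LinAlg

/-! ### Cyclic products -/

/-- The product `g k * g (k + 1) * ⋯ * g (k + i - 1)` of `i` consecutive terms of a family
indexed cyclically by `Fin m`. -/
def cycProd {M : Type*} [Monoid M] {m : ℕ} [NeZero m] (g : Fin m → M) : Fin m → ℕ → M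
  | _, 0 => 1
  | k, i + 1 => g k * cycProd g (k + 1) i

section CycProd

variable {M : Type*} [Monoid M] {m : ℕ} [NeZero m] (g : Fin m → M)

@[simp] lemma cycProd_zero (k : Fin m) : cycProd g k 0 = 1 := rfl

lemma cycProd_succ (k : Fin m) (i : ℕ) : cycProd g k (i + 1) = g k * cycProd g (k + 1) i := rfl

lemma cycProd_add (k : Fin m) (i j : ℕ) :
    cycProd g k (i + j) = cycProd g k i * cycProd g (k + i • 1) j := by
  induction i generalizing k with
  | zero => simp
  | succ i ih =>
    rw [Nat.succ_add, cycProd_succ, ih, cycProd_succ, mul_assoc, succ_nsmul', add_assoc]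

lemma cycProd_succ' (k : Fin m) (i : ℕ) : cycProd g k (i + 1) = cycProd g k i * g (k + i • 1) := by
  rw [cycProd_add, cycProd_succ, cycProd_zero, mul_one]

lemma map_cycProd {N F : Type*} [Monoid N] [FunLike F M N] [MonoidHomClass F M N] (f : F)
    (k : Fin m) (i : ℕ) : f (cycProd g k i) = cycProd (fun k => f (g k)) k i := by
  induction i generalizing k with
  | zero => simp
  | succ i ih => rw [cycProd_succ, cycProd_succ, map_mul, ih]

lemma cycProd_const (a : M) (k : Fin m) (i : ℕ) : cycProd (fun _ => a) k i = a ^ i := by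
  induction i generalizing k with
  | zero => simp
  | succ i ih => rw [cycProd_succ, ih, pow_succ']

lemma nsmul_one_self : m • (1 : Fin m) = 0 := by
  have := card_nsmul_eq_zero (G := Fin m) (x := 1)
  rwa [Fintype.card_fin] at this

lemma val_nsmul_one' (i : ℕ) : ((i • (1 : Fin m) : Fin m) : ℕ) = i % m := by
  induction i with
  | zero => simp
  | succ i ih => rw [succ_nsmul, Fin.val_add, ih, Fin.val_one', ← Nat.add_mod]

lemma val_nsmul_one (k : Fin m) : (k : ℕ) • (1 : Fin m) = k :=
  Fin.ext ((val_nsmul_one' k).trans (Nat.mod_eq_of_lt k.2))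

lemma mul_nsmul_one (i : ℕ) : (m * i) • (1 : Fin m) = 0 := by
  rw [mul_comm, mul_nsmul', nsmul_one_self, nsmul_zero]

end CycProd

/-! ### Weighted cyclic shifts -/

section CycShift

variable {K V : Type*} [Field K] [AddCommGroup V] [Module K V]
  {m : ℕ} [NeZero m]

/-- The weighted cyclic shift `(T d) k = g k (d (k + 1))` on `V ^ m`. -/
def cycShift (g : Fin m → Module.End K V) : Module.End K (Fin m → V) :=
  LinearMap.pi fun k => g k ∘ₗ LinearMap.proj (k + 1)

lemma cycShift_apply (g : Fin m → Module.End K V) (d : Fin m → V) (k : Fin m) :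
    cycShift g d k = g k (d (k + 1)) := rfl

lemma cycShift_pow_apply (g : Fin m → Module.End K V) (i : ℕ) (d : Fin m → V) (k : Fin m) :
    (cycShift g ^ i) d k = cycProd g k i (d (k + i • 1)) := by
  induction i generalizing k with
  | zero => simp
  | succ i ih =>
    rw [pow_succ', Module.End.mul_apply, cycShift_apply, ih, cycProd_succ, Module.End.mul_apply,
      succ_nsmul', add_assoc]

variable [FiniteDimensional K V]

lemma det_neg_one_of_even (hV : Even (Module.finrank K V)) :
    LinearMap.det (-1 : Module.End K V) = 1 := by
  rw [← neg_one_smul K (1 : Module.End K V), LinearMap.det_smul, map_one, hV.neg_one_pow, mul_one]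

/-- Subtracting the identity from a weighted cyclic shift leaves the determinant of the monodromy
minus the identity: eliminate all coordinates except `d 0`. -/
theorem det_cycShift_sub_one (hV : Even (Module.finrank K V)) (g : Fin m → Module.End K V) :
    LinearMap.det (cycShift g - 1) = LinearMap.det (cycProd g 0 m - 1) := by
  let U : (Fin m → V) →ₗ[K] (Fin m → V) := LinearMap.pi fun k =>
    cycProd g k (m - k) ∘ₗ LinearMap.proj 0 +
      (if k = 0 then 1 - cycProd g k (m - k) else 1) ∘ₗ LinearMap.proj k
  -- away from the index `0`, `U` adds to `d` the family which extends `d 0` and is fixed by `T` at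
  -- all other indices, so that the product `(T - 1) * U` is triangular
  have hU0 : ∀ d, U d 0 = d 0 := fun d => by simp [U]
  have hU : ∀ d k, k ≠ 0 → U d k = cycProd g k (m - k) (d 0) + d k := fun d k hk => by
    simp [U, hk]
  have hU' : ∀ d k, U d (k + 1) = cycProd g (k + 1) (m - (k + 1)) (d 0) +
      if (k : ℕ) + 1 < m then d (k + 1) else 0 := by
    intro d k
    by_cases hk : (k : ℕ) + 1 < m
    · have hv : ((k + 1 : Fin m) : ℕ) = k + 1 := by
        rw [Fin.val_add, Fin.val_one', Nat.add_mod_mod, Nat.mod_eq_of_lt hk]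
      rw [hU, if_pos hk, hv]
      intro h
      rw [h] at hv
      simp at hv
    · have hk' : (k : ℕ) + 1 = m := by have := k.2; omega
      have hv : (k + 1 : Fin m) = 0 := by
        apply Fin.ext
        rw [Fin.val_add, Fin.val_one', Nat.add_mod_mod, hk']
        simp
      rw [if_neg hk, hk', hv, hU0]
      simp
  have hdU : LinearMap.det U = 1 := by
    refine (det_eq_of_triangular (fun k : Fin m => (k : ℕ)) U (fun _ => 1)
      fun k δ h => ?_).trans (by simp)
    by_cases hk : k = 0
    · subst hk; exact hU0 δ
    · rw [hU _ _ hk, h 0 (by simpa [Fin.pos_iff_ne_zero] using hk)]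
      simp
  have hT : LinearMap.det ((cycShift g - 1) * U) = LinearMap.det (cycProd g 0 m - 1) := by
    rw [det_eq_of_triangular (fun k : Fin m => m - (k : ℕ)) _
      (fun k => if k = 0 then cycProd g 0 m - 1 else -1)]
    · rw [Finset.prod_eq_single 0]
      · simp
      · intro k _ hk
        rw [if_neg hk, det_neg_one_of_even hV]
      · simp
    · intro k δ h
      have hk1 : g k ((if (k : ℕ) + 1 < m then δ (k + 1) else 0)) = 0 := by
        split_ifs with hk
        · rw [h, map_zero]
          have hv : ((k + 1 : Fin m) : ℕ) = k + 1 := by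
            rw [Fin.val_add, Fin.val_one', Nat.add_mod_mod, Nat.mod_eq_of_lt hk]
          omega
        · simp
      have hrec : cycProd g k (m - k) = g k * cycProd g (k + 1) (m - (k + 1)) := by
        rw [← cycProd_succ]
        congr 1
        omega
      rw [Module.End.mul_apply, LinearMap.sub_apply, Pi.sub_apply, cycShift_apply, hU', map_add,
        hk1, add_zero, ← Module.End.mul_apply, ← hrec, Module.End.one_apply]
      by_cases hk : k = 0
      · subst hk
        simp [hU0]
      · rw [hU _ _ hk, if_neg hk]
        simp
  rw [← hT, map_mul, hdU, mul_one]

/-- If `y ^ q` is the scalar `c`, the operator `d ↦ (k ↦ y (d (k + μ p)))` on `V ^ (μ q)` splits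
into `μ` weighted cyclic shifts of length `q`. -/
theorem det_shift_sub_one {μ p q : ℕ} [NeZero μ] [NeZero q] (hpq : p.Coprime q)
    (hV : Even (Module.finrank K V)) (y : Module.End K V) (c : K)
    (hy : y ^ q = c • (1 : Module.End K V)) (A : Module.End K (Fin (μ * q) → V))
    (hA : ∀ d k, A d k = y (d (k + (μ * p) • 1))) :
    LinearMap.det (A - 1) = (c - 1) ^ (μ * Module.finrank K V) := by
  let f : Fin q × Fin μ → Fin (μ * q) := fun x => ((x.2 : ℕ) + μ * (p * x.1)) • 1
  have hf : Function.Injective f := by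
    rintro ⟨a, r⟩ ⟨a', r'⟩ h
    have h1 := congrArg Fin.val h
    simp only [f, val_nsmul_one'] at h1
    have h2 : (r : ℕ) ≡ r' [MOD μ] := by
      have := Nat.ModEq.of_mul_right q (show _ ≡ _ [MOD μ * q] from h1)
      simpa [Nat.ModEq] using this
    have hr : r = r' := Fin.ext (Nat.ModEq.eq_of_lt_of_lt h2 r.2 r'.2)
    subst hr
    have h3 : μ * (p * a) ≡ μ * (p * a') [MOD μ * q] := Nat.ModEq.add_left_cancel' _ h1
    have h4 := Nat.ModEq.mul_left_cancel' (NeZero.ne μ) h3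
    have h5 : (a : ℕ) ≡ a' [MOD q] := Nat.ModEq.cancel_left_of_coprime hpq.symm h4
    rw [Fin.ext (Nat.ModEq.eq_of_lt_of_lt h5 a.2 a'.2)]
  have hbij : Function.Bijective f :=
    (Fintype.bijective_iff_injective_and_card f).2 ⟨hf, by simp [mul_comm]⟩
  let e₀ := Equiv.ofBijective f hbij
  let e : (Fin (μ * q) → V) ≃ₗ[K] (Fin q → Fin μ → V) :=
    { toFun d a r := d (e₀ (a, r))
      invFun φ k := φ (e₀.symm k).1 (e₀.symm k).2
      map_add' _ _ := rfl
      map_smul' _ _ := rfl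
      left_inv d := by funext k; simp
      right_inv φ := by funext a r; simp }
  let Y : Module.End K (Fin μ → V) := LinearMap.pi fun r => y ∘ₗ LinearMap.proj r
  have hYpow : ∀ i φ r, (Y ^ i) φ r = (y ^ i) (φ r) := by
    intro i
    induction i with
    | zero => simp
    | succ i ih =>
      intro φ r
      rw [pow_succ, pow_succ, Module.End.mul_apply, Module.End.mul_apply, ih]
      rfl
  have hYq : Y ^ q = c • (1 : Module.End K (Fin μ → V)) := by
    refine LinearMap.ext fun φ => funext fun r => ?_
    rw [hYpow, hy]
    rfl
  have hfr : Module.finrank K (Fin μ → V) = μ * Module.finrank K V := by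
    rw [Module.finrank_pi_fintype]
    simp
  rw [← LinearMap.det_conj _ e]
  have hconj : (e : (Fin (μ * q) → V) →ₗ[K] (Fin q → Fin μ → V)) ∘ₗ (A - 1) ∘ₗ
      (e.symm : (Fin q → Fin μ → V) →ₗ[K] _) = cycShift (fun _ => Y) - 1 := by
    refine LinearMap.ext fun φ => funext fun a => funext fun r => ?_
    have hidx : f (a, r) + (μ * p) • 1 = f (a + 1, r) := by
      apply Fin.ext
      have h1 : p * (a + 1) ≡ p * ((a + 1 : Fin q) : ℕ) [MOD q] := by
        rw [Fin.val_add, Fin.val_one', Nat.add_mod_mod]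
        exact (Nat.mod_modEq _ _).symm.mul_left p
      have h2 := (h1.mul_left' μ).add_left (r : ℕ)
      simp only [f]
      rw [← add_nsmul, val_nsmul_one', val_nsmul_one']
      refine Eq.trans ?_ h2
      ring_nf
    change (A - 1) (e.symm φ) (f (a, r)) = _
    rw [LinearMap.sub_apply, LinearMap.sub_apply, Pi.sub_apply, Pi.sub_apply, Pi.sub_apply, hA,
      cycShift_apply, hidx]
    change y ((e (e.symm φ)) (a + 1) r) - (e (e.symm φ)) a r = _
    rw [e.apply_symm_apply]
    rfl
  rw [hconj, det_cycShift_sub_one (by rw [hfr]; exact hV.mul_left _), cycProd_const, hYq,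
    show c • (1 : Module.End K (Fin μ → V)) - 1 = (c - 1) • (1 : Module.End K (Fin μ → V)) from
      LinearMap.ext fun _ => by simp [sub_smul],
    LinearMap.det_smul, map_one, mul_one, hfr]

end CycShift

/-! ### The group of a torus link -/

/-- The relations between the meridians `s k i` of the strands at the positions `i < n` at the
bottom of the blocks `k : Fin m` in the closure of `(σ_1 ⋯ σ_{n-1})^m`, in an arbitrary monoid:
the Wirtinger relations, and the identity of the last strand with the overcrossing strand of the
preceding block. Values `s k i` with `n ≤ i` are irrelevant. -/
structure IsTorusFamily {M : Type*} [Monoid M] {m : ℕ} [NeZero m] (n : ℕ) (s : Fin m → ℕ → M) :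
    Prop where
  wirtinger : ∀ k i, i + 1 < n → s k 0 * s (k + 1) i = s k (i + 1) * s k 0
  last : ∀ k, s (k + 1) (n - 1) = s k 0

namespace IsTorusFamily

variable {M : Type*} [Monoid M] {m n : ℕ} [NeZero m] {s : Fin m → ℕ → M}

lemma map (h : IsTorusFamily n s) {N F : Type*} [Monoid N] [FunLike F M N] [MonoidHomClass F M N]
    (f : F) : IsTorusFamily n (fun k i => f (s k i)) where
  wirtinger k i hi := by rw [← map_mul, ← map_mul, h.wirtinger k i hi]
  last k := by rw [h.last]

/-- The meridian at position `i` is `g_{k+i}` conjugated by `g_k ⋯ g_{k+i-1}`. -/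
lemma mul_cycProd (h : IsTorusFamily n s) (k : Fin m) (i : ℕ) (hi : i < n) :
    s k i * cycProd (fun k => s k 0) k i = cycProd (fun k => s k 0) k (i + 1) := by
  induction i generalizing k with
  | zero => simp [cycProd_succ]
  | succ i ih =>
    rw [cycProd_succ, ← mul_assoc, ← h.wirtinger k i hi, mul_assoc, ih (k + 1) (by omega)]
    rfl

/-- The product of the first meridians of `n` successive blocks is the same from every block: it is
the class of a loop around all strands. -/
lemma cycProd_eq_succ (h : IsTorusFamily n s) (hn : 0 < n) (k : Fin m) :
    cycProd (fun k => s k 0) (k + 1) n = cycProd (fun k => s k 0) k n := by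
  obtain ⟨n, rfl⟩ := Nat.exists_eq_succ_of_ne_zero hn.ne'
  rw [Nat.succ_eq_add_one, ← h.mul_cycProd _ _ (by omega), cycProd_succ, ← h.last k]
  rfl

lemma cycProd_eq (h : IsTorusFamily n s) (hn : 0 < n) (k : Fin m) :
    cycProd (fun k => s k 0) k n = cycProd (fun k => s k 0) 0 n := by
  rw [← val_nsmul_one k]
  generalize (k : ℕ) = i
  induction i with
  | zero => simp
  | succ i ih => rw [succ_nsmul, h.cycProd_eq_succ hn, ih]

end IsTorusFamily

section

variable {M : Type*} [Monoid M] {m n : ℕ} [NeZero m] {g : Fin m → M} {y : M}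

lemma cycProd_mul_eq_pow (k : Fin m) (j : ℕ) : cycProd g k (m * j) = cycProd g k m ^ j := by
  induction j with
  | zero => simp
  | succ j ih => rw [Nat.mul_succ, cycProd_add, ih, mul_nsmul_one, add_zero, pow_succ]

lemma cycProd_mul_eq_pow_of_const (h : ∀ k, cycProd g k n = y) (k : Fin m) (j : ℕ) :
    cycProd g k (n * j) = y ^ j := by
  induction j with
  | zero => simp
  | succ j ih => rw [Nat.mul_succ, cycProd_add, ih, h, pow_succ]

lemma cycProd_pow_eq_pow (h : ∀ k, cycProd g k n = y) {p q : ℕ} (hpq : m * p = n * q) (k : Fin m) :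
    cycProd g k m ^ p = y ^ q := by
  rw [← cycProd_mul_eq_pow, hpq, cycProd_mul_eq_pow_of_const h]

/-- The family `g` is invariant under conjugation by the common product of `n` successive terms up to
the shift by `n`, hence commutes with the powers for which the shift is trivial. -/
lemma commute_pow (h : ∀ k, cycProd g k n = y) {p q : ℕ} (hpq : m * p = n * q) (k : Fin m) :
    Commute (g k) (y ^ q) := by
  have h1 := cycProd_succ g k (n * q)
  rw [cycProd_succ', cycProd_mul_eq_pow_of_const h, cycProd_mul_eq_pow_of_const h, ← hpq,
    mul_nsmul_one, add_zero] at h1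
  exact h1.symm

lemma cycProd_mul_comm (k : Fin m) : g k * cycProd g (k + 1) m = cycProd g k m * g k := by
  rw [← cycProd_succ, cycProd_succ', nsmul_one_self, add_zero]

lemma Commute.cycProd_right {z : M} (h : ∀ k, Commute z (g k)) (k : Fin m) (i : ℕ) :
    Commute z (cycProd g k i) := by
  induction i generalizing k with
  | zero => exact Commute.one_right z
  | succ i ih => exact (h k).mul_right (ih _)

end

/-- For a torus knot the cores generate the group; hence if one of them is central then the group
is cyclic, and all the meridians coincide. -/
lemma eq_of_core_central {H : Type*} [Group H] {m n : ℕ} [NeZero m] {g : Fin m → H} {y : H}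
    (hmn : n.Coprime m) (hn : 0 < n) (h : ∀ k, cycProd g k n = y)
    (hc : (∀ k, Commute (cycProd g 0 m) (g k)) ∨ ∀ k, Commute y (g k)) (k : Fin m) :
    g k = g 0 := by
  -- the product of `n * a = m * b + 1` terms can be split into blocks of either length
  obtain ⟨a, b, hab⟩ : ∃ a b, n * a = m * b + 1 := by
    rcases Nat.lt_or_ge 1 m with hm | hm
    · obtain ⟨a, ha, ha'⟩ := Nat.exists_mul_mod_eq_one_of_coprime hmn hm
      exact ⟨a, n * a / m, by have := Nat.div_add_mod (n * a) m; omega⟩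
    · have : m = 1 := le_antisymm hm (NeZero.pos m)
      exact ⟨1, n - 1, by rw [this]; omega⟩
  have h1 : ∀ k, cycProd g k m ^ b * g k = y ^ a := fun k => by
    rw [← cycProd_mul_eq_pow_of_const h k, hab, cycProd_succ', cycProd_mul_eq_pow, mul_nsmul_one,
      add_zero]
  have h2 : ∀ k, cycProd g k m = cycProd g 0 m := by
    intro k
    rw [← val_nsmul_one k]
    generalize (k : ℕ) = i
    induction i with
    | zero => simp
    | succ i ih =>
      rw [succ_nsmul, ← ih]
      apply mul_left_cancel (a := g (i • 1))
      rw [cycProd_mul_comm]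
      rcases hc with hc | hc
      · rw [ih]; exact hc _
      · have h3 : g (i • 1) = (cycProd g (i • 1) m ^ b)⁻¹ * y ^ a := by
          rw [← h1 (i • 1), inv_mul_cancel_left]
        rw [h3]
        exact ((Commute.refl _).pow_right b).inv_right.mul_right
          ((Commute.cycProd_right hc _ _).symm.pow_right a)
  apply mul_left_cancel (a := cycProd g 0 m ^ b)
  rw [h1, ← h2 k, h1]

lemma LinkDiagram.wirtinger_relation {A C : Type} {μ : ℕ} (D : LinkDiagram A C μ) (c : C) :
    D.meridian (D.overArc c) ^ (D.sign c : ℤ) * D.meridian (D.outArc c) =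
      D.meridian (D.inArc c) * D.meridian (D.overArc c) ^ (D.sign c : ℤ) := by
  have h1 : PresentedGroup.mk (Set.range D.relator) (D.relator c) = 1 :=
    PresentedGroup.one_of_mem ⟨c, rfl⟩
  rw [LinkDiagram.relator, map_mul, map_mul, map_mul, map_inv, map_inv, map_zpow] at h1
  exact mul_inv_eq_iff_eq_mul.1 (mul_inv_eq_one.1 h1)

section TorusGroup

variable (μ p q : ℕ) [NeZero μ] [NeZero p] [NeZero q] (hpq : p.Coprime q)

/-- The meridian of the strand at position `i` at the bottom of block `k`; the value `1` for
`μ p ≤ i` is arbitrary. -/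
def torusMeridian (k : Fin (μ * q)) (i : ℕ) : (torusLinkDiagram μ p q hpq).linkGroup :=
  if h : i < μ * p then
    (torusLinkDiagram μ p q hpq).meridian (torusStrand (μ * p) (μ * q) k ⟨i, h⟩) else 1

lemma torusMeridian_of_lt (k : Fin (μ * q)) (i : Fin (μ * p)) :
    (torusLinkDiagram μ p q hpq).meridian (torusStrand (μ * p) (μ * q) k i) =
      torusMeridian μ p q hpq k i := by
  rw [torusMeridian, dif_pos i.2]

lemma fin_succ_eq_mk {n : ℕ} [NeZero n] (i : Fin n) (h : (i : ℕ) + 1 < n) : i + 1 = ⟨i + 1, h⟩ := by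
  apply Fin.ext
  rw [Fin.val_add, Fin.val_one', Nat.add_mod_mod, Nat.mod_eq_of_lt h]

lemma torusStrand_last (n m : ℕ) [NeZero n] [NeZero m] (k : Fin m) (h : n - 1 < n) :
    torusStrand n m (k + 1) ⟨n - 1, h⟩ = torusStrand n m k 0 := by
  have h0 : ¬ (n - 1 + 1 < n) := by omega
  by_cases h1 : n = 1
  · simp [torusStrand, h1]
  · have h2 : (0 : Fin n).val + 1 < n := by simp only [Fin.val_zero]; omega
    simp only [torusStrand, h0, h1, h2, dif_pos, dif_neg, not_false_eq_true, add_sub_cancel_right]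

lemma isTorusFamily_torusMeridian : IsTorusFamily (μ * p) (torusMeridian μ p q hpq) where
  wirtinger k i hi := by
    let c : TorusCrossing (μ * p) (μ * q) := ⟨(k, ⟨i, by omega⟩), hi⟩
    have h1 := (torusLinkDiagram μ p q hpq).wirtinger_relation c
    have h2 : (c.1.2 + 1 : Fin (μ * p)) = ⟨i + 1, hi⟩ := fin_succ_eq_mk _ hi
    simp only [torusLinkDiagram, Units.val_one, h2] at h1
    simp only [torusMeridian, dif_pos hi, dif_pos (show i < μ * p by omega),
      dif_pos (show 0 < μ * p by omega)]
    exact h1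
  last k := by
    have h1 : 0 < μ * p := NeZero.pos _
    simp only [torusMeridian, dif_pos h1, dif_pos (show μ * p - 1 < μ * p by omega),
      torusStrand_last]
    rfl

lemma list_ofFn_prod_eq_cycProd {M : Type*} [Monoid M] {m : ℕ} [NeZero m] (g : Fin m → M)
    (k : Fin m) (j : ℕ) :
    (List.ofFn fun i : Fin j => g (k + (i : ℕ) • 1)).prod = cycProd g k j := by
  induction j generalizing k with
  | zero => simp
  | succ j ih =>
    rw [List.ofFn_succ, List.prod_cons, cycProd_succ, ← ih]
    simp only [Fin.val_zero, zero_nsmul, add_zero, Fin.val_succ, succ_nsmul', add_assoc]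

lemma torusCoreX_eq : torusCoreX μ p q hpq =
    cycProd (fun k => torusMeridian μ p q hpq k 0) 0 (μ * q) := by
  rw [← list_ofFn_prod_eq_cycProd, torusCoreX]
  congr 2
  funext k
  rw [torusMeridian_of_lt, zero_add, val_nsmul_one]
  rfl

lemma torusCoreY_eq : torusCoreY μ p q hpq =
    cycProd (fun k => torusMeridian μ p q hpq k 0) 0 (μ * p) := by
  have h : ∀ j, j ≤ μ * p → (List.ofFn fun i : Fin j => torusMeridian μ p q hpq 0 i.rev).prod =
      cycProd (fun k => torusMeridian μ p q hpq k 0) 0 j := by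
    intro j
    induction j with
    | zero => simp
    | succ j ih =>
      intro hj
      rw [List.ofFn_succ, List.prod_cons, ← (isTorusFamily_torusMeridian μ p q hpq).mul_cycProd _ _
        (by omega : j < μ * p), ← ih (by omega)]
      simp [Fin.rev_succ]
  rw [← h _ le_rfl, torusCoreY]
  congr 2
  funext k
  rw [torusMeridian_of_lt]

variable {μ p q hpq} in
/-- The link group is generated by the meridians of the overcrossing arcs. -/
lemma torus_closure_induction {H : Type*} [Group H]
    (f : (torusLinkDiagram μ p q hpq).linkGroup →* H)
    (S : Subgroup H) (h : ∀ k, f (torusMeridian μ p q hpq k 0) ∈ S) (g) : f g ∈ S := by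
  have hs : ∀ i, i ≤ μ * p → ∀ k, f (cycProd (fun k => torusMeridian μ p q hpq k 0) k i) ∈ S := by
    intro i hi
    induction i with
    | zero => intro k; simp [S.one_mem]
    | succ i ih =>
      intro k
      rw [cycProd_succ', map_mul]
      exact S.mul_mem (ih (by omega) k) (h _)
  have h1 : Subgroup.closure (Set.range (PresentedGroup.of)) ≤ S.comap f := by
    rw [Subgroup.closure_le]
    rintro _ ⟨⟨⟨k, i⟩, hi⟩, rfl⟩
    have h2 : torusStrand (μ * p) (μ * q) k i = ⟨(k, i), hi⟩ := by
      unfold torusStrand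
      rcases hi with hi | ⟨hi, hk⟩
      · rw [dif_pos hi]
      · have := i.2
        rw [dif_neg (by omega), dif_pos hi]
        simp only at hk
        subst hk
        congr
        apply Fin.ext
        simp only [Fin.val_zero]
        omega
    have h3 : PresentedGroup.of ⟨(k, i), hi⟩ = torusMeridian μ p q hpq k i := by
      rw [← torusMeridian_of_lt, h2]
      rfl
    rw [h3, SetLike.mem_coe, Subgroup.mem_comap,
      eq_mul_inv_of_mul_eq ((isTorusFamily_torusMeridian μ p q hpq).mul_cycProd k i i.2), map_mul,
      map_inv]
    exact S.mul_mem (hs _ (by have := i.2; omega) _) (S.inv_mem (hs _ i.2.le _))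
  rw [PresentedGroup.closure_range_of] at h1
  exact h1 (Subgroup.mem_top g)

lemma torusCoreX_pow : torusCoreX μ p q hpq ^ p = torusCoreY μ p q hpq ^ q := by
  rw [torusCoreX_eq, torusCoreY_eq]
  exact cycProd_pow_eq_pow ((isTorusFamily_torusMeridian μ p q hpq).cycProd_eq (NeZero.pos _))
    (by ring) 0

lemma commute_torusCoreY_pow (g : (torusLinkDiagram μ p q hpq).linkGroup) :
    Commute g (torusCoreY μ p q hpq ^ q) := by
  have := torus_closure_induction (hpq := hpq) (MonoidHom.id _)
    (Subgroup.centralizer {torusCoreY μ p q hpq ^ q}) (fun k => ?_) g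
  · exact (Subgroup.mem_centralizer_singleton_iff.1 this)
  · rw [Subgroup.mem_centralizer_singleton_iff, torusCoreY_eq]
    exact commute_pow ((isTorusFamily_torusMeridian μ p q hpq).cycProd_eq (NeZero.pos _))
      (by ring : μ * q * p = μ * p * q) k

end TorusGroup

/-! ### Irreducible representations -/

section Irreducible

variable {G : Type} [Group G] {ρ : G →* SL2C}

/-- Schur's lemma. -/
lemma IsIrreducibleRep.eq_smul_one (h : IsIrreducibleRep ρ) (Z : Matrix (Fin 2) (Fin 2) ℂ)
    (hZ : ∀ g, Z * (ρ g : Matrix (Fin 2) (Fin 2) ℂ) = ρ g * Z) : ∃ c : ℂ, Z = c • 1 := by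
  obtain ⟨c, hc⟩ := Module.End.exists_eigenvalue (Matrix.toLin' Z)
  refine ⟨c, ?_⟩
  have hinv : ∀ g, ∀ v ∈ Module.End.eigenspace (Matrix.toLin' Z) c,
      (ρ g : Matrix (Fin 2) (Fin 2) ℂ) *ᵥ v ∈ Module.End.eigenspace (Matrix.toLin' Z) c := by
    intro g v hv
    rw [Module.End.mem_eigenspace_iff, Matrix.toLin'_apply] at hv ⊢
    rw [Matrix.mulVec_mulVec, hZ, ← Matrix.mulVec_mulVec, hv, Matrix.mulVec_smul]
  rcases h _ hinv with h0 | h0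
  · exact absurd h0 hc
  · apply Matrix.toLin'.injective
    refine LinearMap.ext fun v => ?_
    have hv : v ∈ Module.End.eigenspace (Matrix.toLin' Z) c := h0 ▸ Submodule.mem_top
    rw [Module.End.mem_eigenspace_iff] at hv
    rw [hv]
    simp

lemma not_isIrreducibleRep_of_scalar
    (h : ∀ g, ∃ c : ℂ, (ρ g : Matrix (Fin 2) (Fin 2) ℂ) = c • 1) : ¬ IsIrreducibleRep ρ := by
  intro hρ
  have hinv : ∀ g, ∀ v ∈ Submodule.span ℂ {(![1, 0] : Fin 2 → ℂ)},
      (ρ g : Matrix (Fin 2) (Fin 2) ℂ) *ᵥ v ∈ Submodule.span ℂ {(![1, 0] : Fin 2 → ℂ)} := by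
    intro g v hv
    obtain ⟨c, hc⟩ := h g
    rw [hc, Matrix.smul_mulVec, Matrix.one_mulVec]
    exact Submodule.smul_mem _ _ hv
  rcases hρ _ hinv with h0 | h0
  · rw [Submodule.span_singleton_eq_bot] at h0
    simpa using congrFun h0 0
  · have h1 : (![0, 1] : Fin 2 → ℂ) ∈ Submodule.span ℂ {(![1, 0] : Fin 2 → ℂ)} :=
      h0 ▸ Submodule.mem_top
    obtain ⟨a, ha⟩ := Submodule.mem_span_singleton.1 h1
    simpa using congrFun ha 1

lemma IsIrreducibleRep.not_commutative (h : IsIrreducibleRep ρ) :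
    ¬ ∀ g g', ρ g * ρ g' = ρ g' * ρ g := fun hc =>
  not_isIrreducibleRep_of_scalar (fun g => h.eq_smul_one _ fun g' => by
    have := congrArg (fun z : SL2C => (z : Matrix (Fin 2) (Fin 2) ℂ)) (hc g g')
    simpa using this) h

end Irreducible

/-! ### Roots of unity and matrices of finite order -/

section RootExp

lemma rootExp_ne_zero (a p : ℕ) : rootExp a p ≠ 0 := Complex.exp_ne_zero _

lemma rootExp_pow (a p : ℕ) [NeZero p] : rootExp a p ^ p = (-1) ^ a := by
  have hp : (p : ℂ) ≠ 0 := Nat.cast_ne_zero.2 (NeZero.ne p)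
  rw [rootExp, ← Complex.exp_nat_mul, ← Complex.exp_pi_mul_I, ← Complex.exp_nat_mul]
  congr 1
  field_simp

lemma exists_rootExp_of_pow (p : ℕ) [NeZero p] (z : ℂ) (hz : (z ^ p) ^ 2 = 1) :
    ∃ a ≤ p, z = rootExp a p ∨ z = (rootExp a p)⁻¹ := by
  have hp : (p : ℂ) ≠ 0 := Nat.cast_ne_zero.2 (NeZero.ne p)
  have h2p : p * 2 ≠ 0 := by have := NeZero.ne p; omega
  have hprim := Complex.isPrimitiveRoot_exp (p * 2) h2p
  have : NeZero (p * 2) := ⟨h2p⟩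
  rw [← pow_mul] at hz
  obtain ⟨i, hi, rfl⟩ := hprim.eq_pow_of_pow_eq_one hz
  have he : Complex.exp (2 * Real.pi * Complex.I / (p * 2 : ℕ)) ^ i = rootExp i p := by
    rw [rootExp, ← Complex.exp_nat_mul]
    congr 1
    push_cast
    field_simp
  rw [he]
  rcases le_or_gt i p with h | h
  · exact ⟨i, h, Or.inl rfl⟩
  · refine ⟨p * 2 - i, by omega, Or.inr ?_⟩
    rw [rootExp, rootExp, ← Complex.exp_neg, Complex.exp_eq_exp_iff_exists_int]
    refine ⟨1, ?_⟩
    rw [Nat.cast_sub (by omega)]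
    push_cast
    field_simp
    ring

end RootExp

section SL2

variable (A : SL2C)

lemma SL2C.ne_zero_and_trace_of_hasEigenvalue {z : ℂ}
    (h : Module.End.HasEigenvalue (Matrix.toLin' (A : Matrix (Fin 2) (Fin 2) ℂ)) z) :
    z ≠ 0 ∧ (A : Matrix (Fin 2) (Fin 2) ℂ).trace = z + z⁻¹ := by
  rw [Module.End.hasEigenvalue_iff_isRoot_charpoly, Matrix.charpoly_toLin',
    Matrix.charpoly_fin_two, Polynomial.IsRoot.def, A.det_coe] at h
  simp only [Polynomial.eval_add, Polynomial.eval_sub, Polynomial.eval_pow, Polynomial.eval_X,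
    Polynomial.eval_mul, Polynomial.eval_C] at h
  have hz : z ≠ 0 := by rintro rfl; simp at h
  refine ⟨hz, ?_⟩
  field_simp
  linear_combination -h

lemma SL2C.hasEigenvalue_of_trace {z : ℂ} (hz : z ≠ 0)
    (h : (A : Matrix (Fin 2) (Fin 2) ℂ).trace = z + z⁻¹) :
    Module.End.HasEigenvalue (Matrix.toLin' (A : Matrix (Fin 2) (Fin 2) ℂ)) z := by
  rw [Module.End.hasEigenvalue_iff_isRoot_charpoly, Matrix.charpoly_toLin',
    Matrix.charpoly_fin_two, Polynomial.IsRoot.def, A.det_coe]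
  simp only [Polynomial.eval_add, Polynomial.eval_sub, Polynomial.eval_pow, Polynomial.eval_X,
    Polynomial.eval_mul, Polynomial.eval_C, h]
  field_simp
  ring

lemma SL2C.pow_eq_of_hasEigenvalue {z c : ℂ} {N : ℕ}
    (h : Module.End.HasEigenvalue (Matrix.toLin' (A : Matrix (Fin 2) (Fin 2) ℂ)) z)
    (hc : (A : Matrix (Fin 2) (Fin 2) ℂ) ^ N = c • 1) : c = z ^ N := by
  obtain ⟨v, hv⟩ := h.exists_hasEigenvector
  have h1 := hv.pow_apply N
  rw [← Matrix.toLin'_pow, hc, Matrix.toLin'_apply, Matrix.smul_mulVec, Matrix.one_mulVec] at h1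
  exact smul_left_injective ℂ hv.2 h1

/-- A matrix in `SL(2, ℂ)` of finite order whose eigenvalues coincide is scalar. -/
lemma SL2C.eq_smul_one_of_pow {z c : ℂ} {N : ℕ} (hN : N ≠ 0) (hz : z * z = 1)
    (h : (A : Matrix (Fin 2) (Fin 2) ℂ).trace = z + z)
    (hc : (A : Matrix (Fin 2) (Fin 2) ℂ) ^ N = c • 1) :
    (A : Matrix (Fin 2) (Fin 2) ℂ) = z • 1 := by
  have hz0 : z ≠ 0 := by rintro rfl; simp at hz
  have hcN := SL2C.pow_eq_of_hasEigenvalue A (SL2C.hasEigenvalue_of_trace A hz0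
    (by rw [h, ← eq_inv_of_mul_eq_one_left hz])) hc
  set B := (A : Matrix (Fin 2) (Fin 2) ℂ) with hB
  have hdet : B.det = 1 := A.det_coe
  -- the nilpotent part of `A`, which vanishes since `A ^ N` is scalar and `N ≠ 0` in `ℂ`
  set n := B - z • (1 : Matrix (Fin 2) (Fin 2) ℂ) with hn
  have hnn : B * n = z • n := by
    rw [Matrix.det_fin_two] at hdet
    rw [Matrix.trace_fin_two] at h
    ext i j
    fin_cases i <;> fin_cases j <;> simp [n, Matrix.mul_apply, Fin.sum_univ_two]
    · linear_combination (B 0 0) * h - hdet + hz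
    · linear_combination (B 0 1) * h
    · linear_combination (B 1 0) * h
    · linear_combination (B 1 1) * h - hdet + hz
  have hpow : ∀ j : ℕ, z • B ^ j = z ^ (j + 1) • (1 : Matrix (Fin 2) (Fin 2) ℂ)
      + (j * z ^ j) • n := by
    intro j
    induction j with
    | zero => simp
    | succ j ih =>
      rw [pow_succ', ← mul_smul_comm, ih, mul_add, mul_smul_comm, mul_smul_comm, hnn, mul_one,
        show B = z • (1 : Matrix (Fin 2) (Fin 2) ℂ) + n by rw [hn]; abel, smul_add, smul_smul,
        smul_smul, add_assoc, ← add_smul, ← pow_succ]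
      congr 2
      push_cast
      ring
  have h1 := hpow N
  rw [hc, smul_smul, hcN, ← pow_succ', left_eq_add, smul_eq_zero] at h1
  have h2 : n = 0 := h1.resolve_left (mul_ne_zero (Nat.cast_ne_zero.2 hN) (pow_ne_zero _ hz0))
  rwa [hn, sub_eq_zero] at h2

lemma SL2C.exists_conj_diag {z c : ℂ} {N : ℕ} (hN : N ≠ 0) (hz : z ≠ 0)
    (h : (A : Matrix (Fin 2) (Fin 2) ℂ).trace = z + z⁻¹)
    (hc : (A : Matrix (Fin 2) (Fin 2) ℂ) ^ N = c • 1) :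
    ∃ S : SL2C, ((S * A * S⁻¹ : SL2C) : Matrix (Fin 2) (Fin 2) ℂ) = !![z, 0; 0, z⁻¹] := by
  by_cases hzz : z = z⁻¹
  · have h1 : z * z = 1 := by nth_rw 2 [hzz]; exact mul_inv_cancel₀ hz
    have h2 := SL2C.eq_smul_one_of_pow A hN h1 (by rw [h, ← hzz]) hc
    refine ⟨1, ?_⟩
    rw [one_mul, inv_one, mul_one, h2, ← hzz]
    ext i j
    fin_cases i <;> fin_cases j <;> simp
  · obtain ⟨v, hv⟩ := (SL2C.hasEigenvalue_of_trace A hz h).exists_hasEigenvector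
    obtain ⟨w, hw⟩ := (SL2C.hasEigenvalue_of_trace A (inv_ne_zero hz)
      (by rw [h, inv_inv, add_comm])).exists_hasEigenvector
    have hv1 := hv.apply_eq_smul
    have hw1 := hw.apply_eq_smul
    rw [Matrix.toLin'_apply] at hv1 hw1
    -- eigenvectors for different eigenvalues are independent
    have hd : v 0 * w 1 - w 0 * v 1 ≠ 0 := by
      intro h0
      have hvw : (v 0) • w = (w 0) • v ∧ (v 1) • w = (w 1) • v := by
        constructor <;> ext i <;> fin_cases i <;> simp
        · ring
        · linear_combination h0
        · linear_combination -h0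
        · ring
      have key : ∀ s t : ℂ, s • w = t • v → s = 0 := by
        intro s t hst
        have h1 := congrArg (fun u => (A : Matrix (Fin 2) (Fin 2) ℂ) *ᵥ u) hst
        simp only [Matrix.mulVec_smul, hv1, hw1] at h1
        rw [smul_comm s, smul_comm t, ← hst, ← sub_eq_zero, ← sub_smul, smul_smul,
          smul_eq_zero] at h1
        have h2 := h1.resolve_right hw.2
        exact (mul_eq_zero.1 h2).resolve_left (sub_ne_zero.2 (Ne.symm hzz))
      apply hv.2
      ext i
      fin_cases i
      · exact key _ _ hvw.1
      · exact key _ _ hvw.2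
    set d := v 0 * w 1 - w 0 * v 1 with hdd
    let P : SL2C := ⟨!![v 0 / d, w 0; v 1 / d, w 1], by
      rw [Matrix.det_fin_two_of]
      field_simp
      rw [hdd]⟩
    refine ⟨P⁻¹, ?_⟩
    have hAP : (A : Matrix (Fin 2) (Fin 2) ℂ) * P = P * !![z, 0; 0, z⁻¹] := by
      have hv0 := congrFun hv1 0
      have hv2 := congrFun hv1 1
      have hw0 := congrFun hw1 0
      have hw2 := congrFun hw1 1
      simp only [Matrix.mulVec, dotProduct, Fin.sum_univ_two, Pi.smul_apply, smul_eq_mul]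
        at hv0 hv2 hw0 hw2
      ext i j
      fin_cases i <;> fin_cases j <;> simp [P, Matrix.mul_apply, Fin.sum_univ_two]
      · field_simp; linear_combination hv0
      · linear_combination hw0
      · field_simp; linear_combination hv2
      · linear_combination hw2
    have hPP : ((P⁻¹ : SL2C) : Matrix (Fin 2) (Fin 2) ℂ) * P = 1 := by
      rw [← Matrix.SpecialLinearGroup.coe_mul, inv_mul_cancel, Matrix.SpecialLinearGroup.coe_one]
    rw [inv_inv, Matrix.SpecialLinearGroup.coe_mul, Matrix.SpecialLinearGroup.coe_mul, mul_assoc,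
      hAP, ← mul_assoc, hPP, one_mul]

/-- An element of `SL(2, ℂ)` with a scalar `N`-th power is conjugate to the diagonal matrix
of a `2N`-th root of unity and its inverse. -/
lemma SL2C.exists_rootExp {c : ℂ} (N : ℕ) [NeZero N]
    (hc : (A : Matrix (Fin 2) (Fin 2) ℂ) ^ N = c • 1) :
    ∃ a ≤ N, c = (-1) ^ a ∧ (A : Matrix (Fin 2) (Fin 2) ℂ).trace = rootExp a N + (rootExp a N)⁻¹ ∧
      ∃ S : SL2C, ((S * A * S⁻¹ : SL2C) : Matrix (Fin 2) (Fin 2) ℂ) =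
        !![rootExp a N, 0; 0, (rootExp a N)⁻¹] := by
  obtain ⟨z, hz⟩ := Module.End.exists_eigenvalue (Matrix.toLin' (A : Matrix (Fin 2) (Fin 2) ℂ))
  obtain ⟨hz0, htr⟩ := SL2C.ne_zero_and_trace_of_hasEigenvalue A hz
  have hc2 : c ^ 2 = 1 := by
    have h1 := congrArg Matrix.det hc
    rw [Matrix.det_pow, A.det_coe, one_pow, Matrix.det_smul, Matrix.det_one, mul_one,
      Fintype.card_fin] at h1
    exact h1.symm
  have hcz := SL2C.pow_eq_of_hasEigenvalue A hz hc
  obtain ⟨a, ha, h⟩ := exists_rootExp_of_pow N z (by rw [← hcz, hc2])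
  have htr' : (A : Matrix (Fin 2) (Fin 2) ℂ).trace = rootExp a N + (rootExp a N)⁻¹ := by
    rcases h with rfl | rfl
    · exact htr
    · rw [htr, inv_inv, add_comm]
  refine ⟨a, ha, ?_, htr', SL2C.exists_conj_diag A (NeZero.ne N) (rootExp_ne_zero a N) htr' hc⟩
  rw [SL2C.pow_eq_of_hasEigenvalue A
    (SL2C.hasEigenvalue_of_trace A (rootExp_ne_zero a N) htr') hc, rootExp_pow]

end SL2

/-! ### The images of the cores -/

section TorusRep

variable {μ p q : ℕ} [NeZero μ] [NeZero p] [NeZero q] {hpq : p.Coprime q}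
  (ρ : IrrRep (torusLinkDiagram μ p q hpq).linkGroup)

/-- The element `x ^ p = y ^ q` is central, so that an irreducible representation sends it to a scalar
matrix. -/
lemma exists_core_pow_eq_smul : ∃ c : ℂ,
    (ρ.1 (torusCoreX μ p q hpq) : Matrix (Fin 2) (Fin 2) ℂ) ^ p = c • 1 ∧
    (ρ.1 (torusCoreY μ p q hpq) : Matrix (Fin 2) (Fin 2) ℂ) ^ q = c • 1 := by
  have hXY := congrArg (fun z : SL2C => (z : Matrix (Fin 2) (Fin 2) ℂ))
    (congrArg ρ.1 (torusCoreX_pow μ p q hpq))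
  simp only [map_pow, Matrix.SpecialLinearGroup.coe_pow] at hXY
  obtain ⟨c, hc⟩ := ρ.2.eq_smul_one
    ((ρ.1 (torusCoreY μ p q hpq) : Matrix (Fin 2) (Fin 2) ℂ) ^ q) fun g => by
      have h := congrArg (fun z : SL2C => (z : Matrix (Fin 2) (Fin 2) ℂ))
        ((commute_torusCoreY_pow μ p q hpq g).map ρ.1).eq
      simpa using h.symm
  exact ⟨c, hXY.trans hc, hc⟩

lemma exists_core_conj : ∃ a b : ℕ, a ≤ p ∧ b ≤ q ∧ a ≡ b [MOD 2] ∧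
    ((ρ.1 (torusCoreX μ p q hpq) : Matrix (Fin 2) (Fin 2) ℂ).trace =
      rootExp a p + (rootExp a p)⁻¹ ∧
    ∃ S : SL2C, ((S * ρ.1 (torusCoreX μ p q hpq) * S⁻¹ : SL2C) : Matrix (Fin 2) (Fin 2) ℂ) =
      !![rootExp a p, 0; 0, (rootExp a p)⁻¹]) ∧
    ((ρ.1 (torusCoreY μ p q hpq) : Matrix (Fin 2) (Fin 2) ℂ).trace =
      rootExp b q + (rootExp b q)⁻¹ ∧
    ∃ S : SL2C, ((S * ρ.1 (torusCoreY μ p q hpq) * S⁻¹ : SL2C) : Matrix (Fin 2) (Fin 2) ℂ) =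
      !![rootExp b q, 0; 0, (rootExp b q)⁻¹]) := by
  obtain ⟨c, hX, hY⟩ := exists_core_pow_eq_smul ρ
  obtain ⟨a, ha, hca, hS⟩ := SL2C.exists_rootExp _ p hX
  obtain ⟨b, hb, hcb, hT⟩ := SL2C.exists_rootExp _ q hY
  refine ⟨a, b, ha, hb, ?_, hS, hT⟩
  rw [hca] at hcb
  rcases Nat.even_or_odd a with h1 | h1 <;> rcases Nat.even_or_odd b with h2 | h2
  · exact (Nat.even_iff.1 h1).trans (Nat.even_iff.1 h2).symm
  · rw [h1.neg_one_pow, h2.neg_one_pow] at hcb; norm_num at hcb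
  · rw [h1.neg_one_pow, h2.neg_one_pow] at hcb; norm_num at hcb
  · exact (Nat.odd_iff.1 h1).trans (Nat.odd_iff.1 h2).symm

/-- For a torus knot, neither core is represented by a scalar matrix. -/
lemma core_ne_smul_one (hμ : μ = 1) (z : ℂ) :
    (ρ.1 (torusCoreX μ p q hpq) : Matrix (Fin 2) (Fin 2) ℂ) ≠ z • 1 ∧
    (ρ.1 (torusCoreY μ p q hpq) : Matrix (Fin 2) (Fin 2) ℂ) ≠ z • 1 := by
  by_contra hcon
  have hfam := (isTorusFamily_torusMeridian μ p q hpq).map ρ.1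
  have hcomm : ∀ A B : SL2C, (A : Matrix (Fin 2) (Fin 2) ℂ) = z • 1 → Commute A B := by
    intro A B h
    apply Subtype.ext
    simp [h]
  have hX : ρ.1 (torusCoreX μ p q hpq) =
      cycProd (fun k => ρ.1 (torusMeridian μ p q hpq k 0)) 0 (μ * q) := by
    rw [torusCoreX_eq, map_cycProd]
  have hY : ρ.1 (torusCoreY μ p q hpq) =
      cycProd (fun k => ρ.1 (torusMeridian μ p q hpq k 0)) 0 (μ * p) := by
    rw [torusCoreY_eq, map_cycProd]
  have hall := eq_of_core_central (by rw [hμ, one_mul, one_mul]; exact hpq) (NeZero.pos (μ * p))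
    (hfam.cycProd_eq (NeZero.pos _)) (by
      rw [← hX, ← hY]
      by_contra! hc
      obtain ⟨⟨k, hk⟩, l, hl⟩ := hc
      exact hcon ⟨fun h => hk (hcomm _ _ h), fun h => hl (hcomm _ _ h)⟩)
  refine ρ.2.not_commutative fun g g' => ?_
  have hz := torus_closure_induction ρ.1 (Subgroup.zpowers (ρ.1 (torusMeridian μ p q hpq 0 0)))
    fun k => by rw [hall k]; exact Subgroup.mem_zpowers _
  obtain ⟨i, hi⟩ := hz g
  obtain ⟨j, hj⟩ := hz g'
  simp only at hi hj
  rw [← hi, ← hj, ← zpow_add, ← zpow_add, add_comm]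

end TorusRep

/-! ### Removing a column of the Alexander matrix -/

section ReplaceRow

variable {K V A : Type*} [Field K] [AddCommGroup V] [Module K V] [FiniteDimensional K V]
  [Fintype A] [DecidableEq A]

/-- Wada's argument: `v` is a right null vector of the block matrix `B`. The determinant of the
square matrix `B_j` obtained by deleting the column `j` is compared with that of the square
matrix `L` obtained by adding a row `z`. -/
theorem det_addRow_mul_det (j : A) (B : (A → V) →ₗ[K] ({i // i ≠ j} → V)) (z : (A → V) →ₗ[K] V)
    (v : A → Module.End K V) (hv : ∀ w, B (fun a => v a w) = 0)
    (Bj : ({i // i ≠ j} → V) →ₗ[K] ({i // i ≠ j} → V))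
    (hBj : ∀ δ, δ j = 0 → B δ = Bj (fun a => δ a))
    (zv : Module.End K V) (hzv : ∀ w, z (fun a => v a w) = zv w)
    (L : (A → V) →ₗ[K] (A → V)) (hLj : ∀ δ, L δ j = z δ)
    (hL : ∀ δ (i : {i // i ≠ j}), L δ i = B δ i) :
    LinearMap.det L * LinearMap.det (v j) = LinearMap.det Bj * LinearMap.det zv := by
  -- the column operation which replaces the column `j` by the null vector
  let Q : (A → V) →ₗ[K] (A → V) := LinearMap.pi fun a =>
    v a ∘ₗ (LinearMap.proj j : (A → V) →ₗ[K] V) + if a = j then 0 else LinearMap.proj a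
  have hQ : ∀ δ, Q δ = (fun a => v a (δ j)) + Function.update δ j 0 := by
    intro δ
    funext a
    by_cases h : a = j
    · subst h; simp [Q]
    · simp [Q, h]
  have hdQ : LinearMap.det Q = LinearMap.det (v j) := by
    refine (det_eq_of_triangular (fun a => if a = j then 0 else 1) Q
      (fun a => if a = j then v j else 1) fun a δ h => ?_).trans ?_
    · rw [hQ]
      by_cases ha : a = j
      · subst ha; simp
      · have h0 := h j (by simp [ha])
        simp [h0, ha]
    · rw [Finset.prod_eq_single j]
      · simp
      · intro a _ ha; simp [ha]
      · simp
  rw [← hdQ, ← LinearMap.det_comp]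
  let L₂ : ({i // ¬ i ≠ j} → V) →ₗ[K] ({i // ¬ i ≠ j} → V) :=
    LinearMap.pi fun i => zv.comp (LinearMap.proj i)
  have hL₂ : LinearMap.det L₂ = LinearMap.det zv := by
    have hc : Fintype.card {i // ¬ i ≠ j} = 1 := by
      rw [Fintype.card_eq_one_iff]
      exact ⟨⟨j, fun h => h rfl⟩, fun ⟨i, hi⟩ => Subtype.ext (not_not.1 hi)⟩
    rw [LinearMap.det_pi, Finset.prod_const, Finset.card_univ, hc, pow_one]
  rw [← hL₂]
  refine det_eq_of_block (fun i => i ≠ j) _ Bj L₂ (fun δ i hi => ?_) (fun δ h i hi => ?_)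
  · rw [LinearMap.comp_apply, hL _ ⟨i, hi⟩, hQ, map_add, hv, zero_add,
      hBj _ (Function.update_self ..)]
    have h0 : (fun a : {i // i ≠ j} => Function.update δ j 0 a) =
        fun a : {i // i ≠ j} => δ a :=
      funext fun a => Function.update_of_ne a.2 _ _
    rw [h0]
  · obtain rfl : i = j := not_not.1 hi
    have h0 : Function.update δ i 0 = 0 := by
      funext a
      by_cases ha : a = i
      · subst ha; simp
      · simp [ha, h a ha]
    rw [LinearMap.comp_apply, hLj, hQ, map_add, h0, map_zero, add_zero, hzv]
    rfl

end ReplaceRow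

/-! ### Elimination in the Alexander matrix -/

section Elimination

variable {K V : Type*} [Field K] [AddCommGroup V] [Module K V] {m n : ℕ}

/-- The crossing in block `k` at which the strand at position `i + 1` passes under. -/
def torusCrossing (k : Fin m) (i : ℕ) (h : i + 1 < n) : TorusCrossing n m :=
  ⟨(k, ⟨i, by omega⟩), h⟩

lemma torusCrossing_inj {k l : Fin m} {i j : ℕ} {hi : i + 1 < n} {hj : j + 1 < n} :
    torusCrossing k i hi = torusCrossing l j hj ↔ k = l ∧ i = j := by
  simp [torusCrossing]

lemma exists_eq_torusCrossing (c : TorusCrossing n m) :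
    ∃ k i, ∃ h : i + 1 < n, c = torusCrossing k i h :=
  ⟨c.1.1, c.1.2, c.2, rfl⟩

variable [NeZero m]

variable (K V m n) in
/-- The value at the strand at position `i` at the bottom of block `k`, where arcs are labelled by
the crossings at the same place. For `i = n - 1` the arc is the overcrossing one of the
preceding block. -/
def strandValue (hn : 2 ≤ n) (k : Fin m) (i : ℕ) : (TorusCrossing n m → V) →ₗ[K] V :=
  if h : i + 1 < n then LinearMap.proj (torusCrossing k i h)
  else LinearMap.proj (torusCrossing (k - 1) 0 (by omega))

variable (hn : 2 ≤ n) (s : Fin m → ℕ → Module.End K V)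

lemma strandValue_of_lt {k : Fin m} {i : ℕ} (h : i + 1 < n) (δ : TorusCrossing n m → V) :
    strandValue K V m n hn k i δ = δ (torusCrossing k i h) := by
  simp [strandValue, h]

lemma strandValue_last (k : Fin m) (δ : TorusCrossing n m → V) :
    strandValue K V m n hn k (n - 1) δ = strandValue K V m n hn (k - 1) 0 δ := by
  rw [strandValue_of_lt hn (by omega : 0 + 1 < n), strandValue, dif_neg (by omega)]
  rfl

/-- The row of the Alexander matrix that belongs to the crossing `(k, i)`: the value of a
derivation on the Wirtinger relator. -/
def relatorRow (k : Fin m) (i : ℕ) : (TorusCrossing n m → V) →ₗ[K] V :=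
  (1 - s k (i + 1)) ∘ₗ strandValue K V m n hn k 0 + s k 0 ∘ₗ strandValue K V m n hn (k + 1) i -
    strandValue K V m n hn k (i + 1)

lemma relatorRow_apply (k : Fin m) (i : ℕ) (δ : TorusCrossing n m → V) :
    relatorRow hn s k i δ = strandValue K V m n hn k 0 δ -
      s k (i + 1) (strandValue K V m n hn k 0 δ) + s k 0 (strandValue K V m n hn (k + 1) i δ) -
        strandValue K V m n hn k (i + 1) δ := rfl

/-- The value of a derivation on the product of the first meridians of `n` successive blocks,
that is, on the core `y`. -/
def coreRow (k : Fin m) : (TorusCrossing n m → V) →ₗ[K] V :=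
  ∑ i ∈ Finset.range n, cycProd (fun k => s k 0) k i ∘ₗ strandValue K V m n hn (k + i • 1) 0

lemma coreRow_apply (k : Fin m) (δ : TorusCrossing n m → V) :
    coreRow hn s k δ = ∑ i ∈ Finset.range n,
      cycProd (fun k => s k 0) k i (strandValue K V m n hn (k + i • 1) 0 δ) := by
  simp [coreRow, LinearMap.sum_apply]

variable {s}

lemma sum_relatorRow (hs : IsTorusFamily n s) (δ : TorusCrossing n m → V) (J : ℕ) (hJ : J + 1 < n)
    (k : Fin m) :
    ∑ i ∈ Finset.range (J + 1),
      cycProd (fun k => s k 0) k i (relatorRow hn s (k + i • 1) (J - i) δ) =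
    (∑ i ∈ Finset.range (J + 1),
      cycProd (fun k => s k 0) k i (strandValue K V m n hn (k + i • 1) 0 δ)) -
    s k (J + 1) (∑ i ∈ Finset.range (J + 1),
      cycProd (fun k => s k 0) k i (strandValue K V m n hn (k + i • 1) 0 δ)) +
    cycProd (fun k => s k 0) k (J + 1) (strandValue K V m n hn (k + (J + 1) • 1) 0 δ) -
    strandValue K V m n hn k (J + 1) δ := by
  induction J generalizing k with
  | zero => simp [relatorRow_apply, cycProd_succ]
  | succ J ih =>
    have hcyc : ∀ i w, cycProd (fun k => s k 0) k (i + 1) w =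
        s k 0 (cycProd (fun k => s k 0) (k + 1) i w) := fun i w => rfl
    have hk : ∀ i : ℕ, k + (i + 1) • 1 = k + 1 + i • 1 := fun i => by
      rw [succ_nsmul', add_assoc]
    have hw : ∀ w, s k (J + 2) (s k 0 w) = s k 0 (s (k + 1) (J + 1) w) := fun w =>
      (LinearMap.congr_fun (hs.wirtinger k (J + 1) hJ) w).symm
    simp only [Finset.sum_range_succ' _ (J + 1), Nat.add_sub_add_right, hcyc, hk, ← map_sum,
      ih (by omega) (k + 1), cycProd_zero, zero_nsmul, add_zero, Nat.sub_zero,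
      Module.End.one_apply, map_add, map_sub, hw]
    rw [relatorRow_apply]
    abel

/-- The sum of conjugated Wirtinger relators along a strand is the relation which says that the
core `y` read from the block `k` is the one read from the preceding block. -/
lemma relatorRow_last (hs : IsTorusFamily n s) (δ : TorusCrossing n m → V) (k : Fin m) :
    relatorRow hn s k (n - 2) δ = coreRow hn s k δ - coreRow hn s (k - 1) δ -
      ∑ i ∈ Finset.range (n - 2),
        cycProd (fun k => s k 0) k (i + 1) (relatorRow hn s (k + (i + 1) • 1) (n - 3 - i) δ) := by
  obtain ⟨N, rfl⟩ := Nat.exists_eq_add_of_le' hn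
  have h := sum_relatorRow hn hs δ N (by omega) k
  have hlast := strandValue_last (K := K) hn k δ
  have hsl := hs.last (k - 1)
  rw [sub_add_cancel] at hsl
  simp only [Nat.add_sub_cancel, show N + 2 - 1 = N + 1 from rfl] at hlast hsl ⊢
  rw [Finset.sum_range_succ', hlast, hsl] at h
  have hc1 : coreRow hn s k δ = (∑ i ∈ Finset.range (N + 1),
      cycProd (fun k => s k 0) k i (strandValue K V m (N + 2) hn (k + i • 1) 0 δ)) +
      cycProd (fun k => s k 0) k (N + 1)
        (strandValue K V m (N + 2) hn (k + (N + 1) • 1) 0 δ) := by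
    rw [coreRow_apply, Finset.sum_range_succ]
  have hc2 : coreRow hn s (k - 1) δ = s (k - 1) 0 (∑ i ∈ Finset.range (N + 1),
      cycProd (fun k => s k 0) k i (strandValue K V m (N + 2) hn (k + i • 1) 0 δ)) +
      strandValue K V m (N + 2) hn (k - 1) 0 δ := by
    rw [coreRow_apply, Finset.sum_range_succ', map_sum]
    congr 1
    · refine Finset.sum_congr rfl fun i _ => ?_
      rw [cycProd_succ, Module.End.mul_apply, sub_add_cancel, succ_nsmul', ← add_assoc,
        sub_add_cancel]
    · simp
  rw [hc1, hc2]
  simp only [cycProd_zero, Nat.sub_zero, Module.End.one_apply, zero_nsmul, add_zero] at h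
  have h3 : ∀ i, N - (i + 1) = N + 2 - 3 - i := fun i => by omega
  simp only [h3] at h
  rw [← sub_eq_zero] at h ⊢
  rw [← h]
  abel

end Elimination

section Elimination

variable {K V : Type*} [Field K] [AddCommGroup V] [Module K V] {m n : ℕ}
  (hn : 2 ≤ n) {s : Fin m → ℕ → Module.End K V}

variable (m) in
/-- The bijection between columns and rows along which the Alexander matrix is eliminated: the
crossing `(k, i)` serves to eliminate the arc `(k, i + 1)` for `i + 2 < n`, and the arc `(k, 0)`
for `i = n - 2`. -/
def eliminationPerm : Equiv.Perm (TorusCrossing n m) where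
  toFun x := if h : (x.1.2 : ℕ) = 0 then torusCrossing x.1.1 (n - 2) (by omega)
    else torusCrossing x.1.1 (x.1.2 - 1) (by have := x.2; omega)
  invFun c := if h : (c.1.2 : ℕ) + 2 < n then torusCrossing c.1.1 (c.1.2 + 1) h
    else torusCrossing c.1.1 0 (by omega)
  left_inv x := by
    obtain ⟨k, i, h, rfl⟩ := exists_eq_torusCrossing x
    by_cases hi : i = 0
    · subst hi
      have h1 : ¬ n - 2 + 2 < n := by omega
      simp [torusCrossing, h1]
    · have h1 : i - 1 + 2 < n := by omega
      have h2 : i - 1 + 1 = i := by omega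
      simp [torusCrossing, hi, h1, h2]
  right_inv c := by
    obtain ⟨k, i, h, rfl⟩ := exists_eq_torusCrossing c
    by_cases hi : i + 2 < n
    · simp [torusCrossing, hi]
    · have h1 : n - 2 = i := by omega
      simp [torusCrossing, hi, h1]

variable [NeZero m]

variable (s) in
/-- The coordinate change that replaces the values at the arcs other than the `(k, 0)` by
the values of the relators that eliminate them. -/
def eliminateMap : (TorusCrossing n m → V) →ₗ[K] (TorusCrossing n m → V) :=
  LinearMap.pi fun c => if (c.1.2 : ℕ) = 0 then LinearMap.proj c
    else relatorRow hn s c.1.1 (c.1.2 - 1)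

lemma eliminateMap_zero (δ : TorusCrossing n m → V) (k : Fin m) (h : 0 + 1 < n) :
    eliminateMap hn s δ (torusCrossing k 0 h) = δ (torusCrossing k 0 h) := rfl

lemma eliminateMap_succ (δ : TorusCrossing n m → V) (k : Fin m) (i : ℕ) (h : i + 1 + 1 < n) :
    eliminateMap hn s δ (torusCrossing k (i + 1) h) = relatorRow hn s k i δ := rfl

variable (s) in
/-- Replaces the values at the arcs `(k, 0)` by the values at the cores. -/
def coreMap : (TorusCrossing n m → V) →ₗ[K] (TorusCrossing n m → V) :=
  LinearMap.pi fun c => if (c.1.2 : ℕ) = 0 then coreRow hn s c.1.1 else LinearMap.proj c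

lemma coreMap_zero (η : TorusCrossing n m → V) (k : Fin m) (h : 0 + 1 < n) :
    coreMap hn s η (torusCrossing k 0 h) = coreRow hn s k η := rfl

lemma coreMap_succ (η : TorusCrossing n m → V) (k : Fin m) (i : ℕ) (h : i + 1 + 1 < n) :
    coreMap hn s η (torusCrossing k (i + 1) h) = η (torusCrossing k (i + 1) h) := rfl

lemma coreRow_eliminateMap (δ : TorusCrossing n m → V) (k : Fin m) :
    coreRow hn s k (eliminateMap hn s δ) = coreRow hn s k δ := by
  simp only [coreRow_apply, strandValue_of_lt hn (show 0 + 1 < n by omega), eliminateMap_zero]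

variable (s) in
/-- The rows of the Alexander matrix in the coordinates given by the cores and the eliminating
relators, where the row of the crossing `(k₀, i₀)` is replaced by the row of the core read from
the block `k₀ - (n - 2 - i₀)`; rows are permuted so that the matrix is triangular. -/
def reducedMap (k₀ : Fin m) (i₀ : ℕ) (h₀ : i₀ + 1 < n) :
    (TorusCrossing n m → V) →ₗ[K] (TorusCrossing n m → V) :=
  LinearMap.pi fun x =>
    let c := Equiv.swap (torusCrossing k₀ i₀ h₀)
      (torusCrossing (k₀ - (n - 2 - i₀) • 1) (n - 2) (by omega)) (eliminationPerm m hn x)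
    if c = torusCrossing k₀ i₀ h₀ then strandValue K V m n hn (k₀ - (n - 2 - i₀) • 1) 0
    else if (c.1.2 : ℕ) + 2 < n then strandValue K V m n hn c.1.1 (c.1.2 + 1)
    else strandValue K V m n hn c.1.1 0 - strandValue K V m n hn (c.1.1 - 1) 0 -
      ∑ i ∈ Finset.range (n - 2), cycProd (fun k => s k 0) c.1.1 (i + 1) ∘ₗ
        strandValue K V m n hn (c.1.1 + (i + 1) • 1) (n - 2 - i)

lemma reducedMap_eq (hs : IsTorusFamily n s) (k₀ : Fin m) (i₀ : ℕ) (h₀ : i₀ + 1 < n)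
    (L : (TorusCrossing n m → V) →ₗ[K] (TorusCrossing n m → V))
    (hL₀ : ∀ δ, L δ (torusCrossing k₀ i₀ h₀) = coreRow hn s (k₀ - (n - 2 - i₀) • 1) δ)
    (hL : ∀ δ k i h, torusCrossing k i h ≠ torusCrossing k₀ i₀ h₀ →
      L δ (torusCrossing k i h) = relatorRow hn s k i δ) :
    LinearMap.funLeft K V ((eliminationPerm m hn).trans
      (Equiv.swap (torusCrossing k₀ i₀ h₀)
        (torusCrossing (k₀ - (n - 2 - i₀) • 1) (n - 2) (by omega)))) ∘ₗ L =
    reducedMap hn s k₀ i₀ h₀ ∘ₗ coreMap hn s ∘ₗ eliminateMap hn s := by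
  refine LinearMap.ext fun δ => funext fun x => ?_
  have h0 : ∀ k, strandValue K V m n hn k 0 (coreMap hn s (eliminateMap hn s δ)) =
      coreRow hn s k δ := fun k => by
    rw [strandValue_of_lt hn (show 0 + 1 < n by omega), coreMap_zero, coreRow_eliminateMap]
  have h1 : ∀ k i, i + 2 < n → strandValue K V m n hn k (i + 1)
      (coreMap hn s (eliminateMap hn s δ)) = relatorRow hn s k i δ := fun k i hi => by
    rw [strandValue_of_lt hn hi, coreMap_succ, eliminateMap_succ]
  simp only [LinearMap.comp_apply, LinearMap.funLeft_apply, reducedMap, LinearMap.pi_apply,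
    Equiv.trans_apply]
  generalize Equiv.swap (torusCrossing k₀ i₀ h₀)
    (torusCrossing (k₀ - (n - 2 - i₀) • 1) (n - 2) _) (eliminationPerm m hn x) = c
  obtain ⟨k, i, hi, rfl⟩ := exists_eq_torusCrossing c
  split_ifs with hc hi2
  · rw [hc, hL₀, h0]
  · rw [hL _ _ _ _ hc]
    exact (h1 k i hi2).symm
  · obtain rfl : i = n - 2 := by simp only [torusCrossing] at hi2; omega
    rw [hL _ _ _ _ hc, relatorRow_last hn hs]
    simp only [LinearMap.sub_apply, LinearMap.sum_apply, LinearMap.comp_apply, h0]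
    congr 1
    refine Finset.sum_congr rfl fun i hi => ?_
    have hi' := Finset.mem_range.1 hi
    have h3 : n - 2 - i = n - 3 - i + 1 := by omega
    rw [h3, h1 _ _ (by omega)]
    rfl

variable [FiniteDimensional K V]

lemma det_eliminateMap (hV : Even (Module.finrank K V)) :
    LinearMap.det (eliminateMap hn s) = 1 := by
  refine (det_eq_of_triangular (fun c => (c.1.2 : ℕ)) _
    (fun c => if (c.1.2 : ℕ) = 0 then 1 else -1) fun c δ h => ?_).trans ?_
  · obtain ⟨k, i, hi, rfl⟩ := exists_eq_torusCrossing c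
    cases i with
    | zero => rw [eliminateMap_zero]; rfl
    | succ i =>
      rw [eliminateMap_succ, relatorRow_apply, strandValue_of_lt hn hi,
        strandValue_of_lt hn (show 0 + 1 < n by omega),
        strandValue_of_lt hn (show i + 1 < n by omega),
        h (torusCrossing k 0 _) (Nat.succ_pos i), h (torusCrossing (k + 1) i _) (Nat.lt_succ_self i)]
      simp [torusCrossing]
  · refine Finset.prod_eq_one fun c _ => ?_
    split_ifs
    · exact map_one _
    · exact det_neg_one_of_even hV

lemma det_coreMap : LinearMap.det (coreMap hn s) =
    LinearMap.det (∑ i ∈ Finset.range n, cycShift (fun k => s k 0) ^ i) := by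
  let e : {c : TorusCrossing n m // (c.1.2 : ℕ) = 0} ≃ Fin m :=
    { toFun c := c.1.1.1
      invFun k := ⟨torusCrossing k 0 (by omega), rfl⟩
      left_inv := by
        rintro ⟨c, hc⟩
        obtain ⟨k, i, hi, rfl⟩ := exists_eq_torusCrossing c
        obtain rfl : i = 0 := hc
        rfl
      right_inv _ := rfl }
  let Λ := LinearEquiv.funCongrLeft K V e
  rw [det_eq_of_block (fun c => (c.1.2 : ℕ) = 0) (coreMap hn s)
    ((Λ : (Fin m → V) →ₗ[K] _) ∘ₗ
      (∑ i ∈ Finset.range n, cycShift (fun k => s k 0) ^ i : Module.End K (Fin m → V)) ∘ₗ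
      (Λ.symm : _ →ₗ[K] (Fin m → V))) LinearMap.id, LinearMap.det_conj, LinearMap.det_id, mul_one]
  · intro δ c hc
    obtain ⟨k, i, hi, rfl⟩ := exists_eq_torusCrossing c
    obtain rfl : i = 0 := hc
    rw [coreMap_zero, coreRow_apply]
    change _ = (∑ i ∈ Finset.range n, cycShift (fun k => s k 0) ^ i : Module.End K (Fin m → V))
      (fun k => δ (torusCrossing k 0 (by omega))) k
    rw [LinearMap.sum_apply, Finset.sum_apply]
    refine Finset.sum_congr rfl fun i _ => ?_
    rw [cycShift_pow_apply, strandValue_of_lt hn (show 0 + 1 < n by omega)]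
  · intro δ _ c hc
    obtain ⟨k, i, hi, rfl⟩ := exists_eq_torusCrossing c
    obtain ⟨i, rfl⟩ := Nat.exists_eq_succ_of_ne_zero hc
    rw [coreMap_succ]
    rfl

/-- The reduced matrix is triangular for the following ranking of its columns: first those of the
arcs `(k, i)` with `0 < i`, then the `(k, 0)` in cyclic order from the block of the core row, where
the rows are differences of successive core rows; last, if there is one, the arc that the omitted
relator should have eliminated, and which the relator `(k', n - 2)` eliminates instead. -/
lemma det_reducedMap (hV : Even (Module.finrank K V)) (k₀ : Fin m) (i₀ : ℕ) (h₀ : i₀ + 1 < n) :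
    LinearMap.det (reducedMap hn s k₀ i₀ h₀) =
      LinearMap.det (cycProd (fun k => s k 0) (k₀ - (n - 2 - i₀) • 1) (n - 2 - i₀)) := by
  set k' := k₀ - (n - 2 - i₀) • 1 with hk'
  let G := cycProd (fun k => s k 0) k' (n - 2 - i₀)
  have hrank : ∀ k : Fin m, k ≠ k' → ((k - 1 - k' : Fin m) : ℕ) < ((k - k' : Fin m) : ℕ) := by
    intro k hk
    have h2 : k - k' = k - 1 - k' + 1 := by abel
    have h1 : k - 1 - k' + 1 ≠ 0 := h2 ▸ sub_ne_zero.2 hk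
    have h3 : ((k - 1 - k' : Fin m) : ℕ) + 1 < m := by
      by_contra h
      have h4 := (k - 1 - k').2
      refine h1 (Fin.ext ?_)
      rw [Fin.val_add, Fin.val_one', Nat.add_mod_mod, le_antisymm h4 (not_lt.1 h)]
      simp
    rw [h2, fin_succ_eq_mk _ h3]
    exact Nat.lt_succ_self _
  have h1 : 0 + 1 < n := by omega
  have h2 : n - 2 + 1 < n := by omega
  -- for `i₀ = n - 2` no index satisfies the second condition
  let f : TorusCrossing n m → ℕ := fun x =>
    if (x.1.2 : ℕ) = 0 then 1 + ((x.1.1 - k' : Fin m) : ℕ)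
    else if x.1.1 = k₀ ∧ (x.1.2 : ℕ) = i₀ + 1 then m + 1 else 0
  refine (det_eq_of_triangular f _
    (fun x => if x.1.1 = k₀ ∧ (x.1.2 : ℕ) = i₀ + 1 then -G else 1) fun x δ h => ?_).trans ?_
  · obtain ⟨k, i, hi, rfl⟩ := exists_eq_torusCrossing x
    have hmid : ∀ l j (hj : j + 1 < n),
        Equiv.swap (torusCrossing k₀ i₀ h₀) (torusCrossing k' (n - 2) h2)
          (eliminationPerm m hn (torusCrossing k i hi)) = torusCrossing l j hj →
        reducedMap hn s k₀ i₀ h₀ δ (torusCrossing k i hi) =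
        if torusCrossing l j hj = torusCrossing k₀ i₀ h₀ then δ (torusCrossing k' 0 h1)
        else if j + 2 < n then strandValue K V m n hn l (j + 1) δ
        else δ (torusCrossing l 0 h1) - δ (torusCrossing (l - 1) 0 h1) -
          ∑ j ∈ Finset.range (n - 2), cycProd (fun k => s k 0) l (j + 1)
            (strandValue K V m n hn (l + (j + 1) • 1) (n - 2 - j) δ) := by
      intro l j hj e
      simp only [reducedMap, LinearMap.pi_apply, ← hk', e]
      split_ifs with h3 h4 h5 h5
      · exact strandValue_of_lt hn h1 δ
      · rfl
      · exact absurd h4 h5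
      · exact absurd h5 h4
      · simp only [LinearMap.sub_apply, LinearMap.sum_apply, LinearMap.comp_apply,
          strandValue_of_lt hn h1]
        rfl
    have hf0 : ∀ l, f (torusCrossing l 0 h1) = 1 + ((l - k' : Fin m) : ℕ) := fun l => rfl
    have hf1 : ∀ l j hj, f (torusCrossing l (j + 1) hj) =
        if l = k₀ ∧ j + 1 = i₀ + 1 then m + 1 else 0 := fun l j hj => rfl
    cases i with
    | zero =>
      by_cases hkk : k = k'
      · subst hkk
        rw [hmid k₀ i₀ h₀ (Equiv.swap_apply_right _ _), if_pos rfl]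
        simp [torusCrossing]
      · have hne : torusCrossing k (n - 2) h2 ≠ torusCrossing k₀ i₀ h₀ := by
          intro h3
          obtain ⟨h3, h4⟩ := torusCrossing_inj.1 h3
          apply hkk
          rw [hk', h3, ← h4, Nat.sub_self, zero_nsmul, sub_zero]
        rw [hmid k (n - 2) h2 (Equiv.swap_apply_of_ne_of_ne hne
          (fun h3 => hkk (torusCrossing_inj.1 h3).1)), if_neg hne, if_neg (by omega),
          Finset.sum_eq_zero]
        · rw [h (torusCrossing (k - 1) 0 h1) (by rw [hf0, hf0]; have := hrank k hkk; omega)]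
          simp [torusCrossing]
        · intro j hj
          have hj' := Finset.mem_range.1 hj
          obtain ⟨l, hl⟩ : ∃ l, n - 2 - j = l + 1 := ⟨n - 3 - j, by omega⟩
          rw [hl, strandValue_of_lt hn (by omega), h _, map_zero]
          rw [hf1, hf0, if_neg]
          · omega
          · rintro ⟨h3, h4⟩
            apply hkk
            rw [hk', ← h3, show n - 2 - i₀ = j + 1 by omega, add_sub_cancel_right]
    | succ i =>
      have hi' : i + 1 < n := by omega
      by_cases hki : torusCrossing k i hi' = torusCrossing k₀ i₀ h₀
      · obtain ⟨rfl, rfl⟩ := torusCrossing_inj.1 hki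
        have hne : torusCrossing k' (n - 2) h2 ≠ torusCrossing k i h₀ := by
          intro h3
          have := (torusCrossing_inj.1 h3).2
          omega
        have hfx : f (torusCrossing k (i + 1) hi) = m + 1 := by rw [hf1, if_pos ⟨rfl, rfl⟩]
        rw [hmid k' (n - 2) h2 (Equiv.swap_apply_left _ _), if_neg hne, if_neg (by omega),
          if_pos ⟨rfl, rfl⟩, Finset.sum_eq_single (n - 3 - i)]
        · rw [h (torusCrossing k' 0 h1) (by rw [hfx, hf0]; have := (k' - k').2; omega),
            h (torusCrossing (k' - 1) 0 h1) (by rw [hfx, hf0]; have := (k' - 1 - k').2; omega),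
            show n - 3 - i + 1 = n - 2 - i by omega, show n - 2 - (n - 3 - i) = i + 1 by omega,
            strandValue_of_lt hn hi, show k' + (n - 2 - i) • 1 = k from sub_add_cancel _ _]
          simp [G]
        · intro j hj hj2
          have hj' := Finset.mem_range.1 hj
          obtain ⟨l, hl⟩ : ∃ l, n - 2 - j = l + 1 := ⟨n - 3 - j, by omega⟩
          rw [hl, strandValue_of_lt hn (by omega), h _, map_zero]
          rw [hf1, hfx, if_neg]
          · omega
          · rintro ⟨h3, h4⟩
            omega
        · intro h3
          exact absurd (Finset.mem_range.2 (by omega)) h3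
      · have hne : torusCrossing k i hi' ≠ torusCrossing k' (n - 2) h2 := by
          intro h3
          have := (torusCrossing_inj.1 h3).2
          omega
        rw [hmid k i hi' (Equiv.swap_apply_of_ne_of_ne hki hne), if_neg hki, if_pos hi, if_neg, strandValue_of_lt hn hi, Module.End.one_apply]
        rintro ⟨h3, h4⟩
        exact hki (torusCrossing_inj.2 ⟨h3, Nat.succ_injective h4⟩)
  · by_cases hi₀ : i₀ + 2 < n
    · rw [Finset.prod_eq_single (torusCrossing k₀ (i₀ + 1) hi₀)]
      · rw [if_pos ⟨rfl, rfl⟩, ← neg_one_mul, map_mul, det_neg_one_of_even hV, one_mul]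
      · intro x _ hx
        obtain ⟨k, i, hi, rfl⟩ := exists_eq_torusCrossing x
        rw [if_neg, map_one]
        rintro ⟨h1, h2⟩
        exact hx (torusCrossing_inj.2 ⟨h1, h2⟩)
      · simp
    · have h1 : n - 2 - i₀ = 0 := by omega
      rw [h1, cycProd_zero, map_one]
      refine Finset.prod_eq_one fun x _ => ?_
      rw [if_neg, map_one]
      rintro ⟨-, h2⟩
      have := x.2
      omega

/-- The determinant of the Alexander matrix with the row of the crossing `(k₀, i₀)` replaced by the
row of the core. -/
theorem det_coreRow_replace (hV : Even (Module.finrank K V)) (hs : IsTorusFamily n s)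
    (k₀ : Fin m) (i₀ : ℕ) (h₀ : i₀ + 1 < n)
    (L : (TorusCrossing n m → V) →ₗ[K] (TorusCrossing n m → V))
    (hL₀ : ∀ δ, L δ (torusCrossing k₀ i₀ h₀) = coreRow hn s (k₀ - (n - 2 - i₀) • 1) δ)
    (hL : ∀ δ k i h, torusCrossing k i h ≠ torusCrossing k₀ i₀ h₀ →
      L δ (torusCrossing k i h) = relatorRow hn s k i δ) :
    LinearMap.det L =
      LinearMap.det (cycProd (fun k => s k 0) (k₀ - (n - 2 - i₀) • 1) (n - 2 - i₀)) *
        LinearMap.det (∑ i ∈ Finset.range n, cycShift (fun k => s k 0) ^ i) := by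
  rw [← det_comp_funLeft hV _ L, reducedMap_eq hn hs k₀ i₀ h₀ L hL₀ hL, LinearMap.det_comp,
    LinearMap.det_comp, det_reducedMap hn hV, det_coreMap, det_eliminateMap hn hV, mul_one]

end Elimination

/-! ### The twisted Alexander matrix of a link diagram -/

namespace LinkDiagram

variable {A C : Type} {μ : ℕ} (D : LinkDiagram A C μ) (ρ : D.linkGroup →* SL2C)

/-- The twisted representation `α_L ⊗ ρ` as a homomorphism to the endomorphisms of
`ℂ(t_1, …, t_μ)²`. -/
def twistedEnd : D.linkGroup →* Module.End (RatFn μ) (Fin 2 → RatFn μ) :=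
  (Matrix.toLinAlgEquiv' : Matrix (Fin 2) (Fin 2) (RatFn μ) ≃ₐ[RatFn μ] _).toAlgHom.toMonoidHom.comp
    (D.tensorRep ρ)

lemma twistedEnd_apply (g : D.linkGroup) (w : Fin 2 → RatFn μ) :
    D.twistedEnd ρ g w = D.tensorRep ρ g *ᵥ w := rfl

lemma twistedEnd_eq (g : D.linkGroup) : D.twistedEnd ρ g = Matrix.toLin' (D.tensorRep ρ g) := rfl

lemma laurentMonomial_meridian (a : A) :
    laurentMonomial μ (D.abelianization (D.meridian a)) = tVar (D.component a) := by
  have h : D.abelianization (D.meridian a) =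
      Multiplicative.ofAdd (Pi.single (D.component a) (1 : ℤ)) := PresentedGroup.toGroup.of _
  rw [h]
  change ∏ i, tVar i ^ (Pi.single (D.component a) (1 : ℤ) : Fin μ → ℤ) i = _
  rw [Finset.prod_eq_single (D.component a)]
  · simp
  · intro i _ hi
    rw [Pi.single_eq_of_ne hi, zpow_zero]
  · simp

lemma Phi_of (w : FreeGroup A) :
    D.Phi ρ (MonoidAlgebra.of ℤ _ w) = D.tensorRep ρ (PresentedGroup.mk _ w) := by
  rw [Phi, MonoidAlgebra.lift_of]
  rfl

lemma det_twistedEnd (g : D.linkGroup) :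
    LinearMap.det (D.twistedEnd ρ g) = laurentMonomial μ (D.abelianization g) ^ 2 := by
  rw [twistedEnd_eq, LinearMap.det_toLin']
  have h : ((ρ g : Matrix (Fin 2) (Fin 2) ℂ).map (algebraMap ℂ (RatFn μ))).det = 1 := by
    have := RingHom.map_det (algebraMap ℂ (RatFn μ)) (ρ g : Matrix (Fin 2) (Fin 2) ℂ)
    rw [(ρ g).det_coe, map_one] at this
    exact this.symm
  change (laurentMonomial μ (D.abelianization g) •
    (ρ g : Matrix (Fin 2) (Fin 2) ℂ).map (algebraMap ℂ (RatFn μ))).det = _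
  rw [Matrix.det_smul, h, mul_one, Fintype.card_fin]

lemma det_twistedEnd_sub_one (g : D.linkGroup) {z : ℂ} (hz : z ≠ 0)
    (h : (ρ g : Matrix (Fin 2) (Fin 2) ℂ).trace = z + z⁻¹) :
    LinearMap.det (D.twistedEnd ρ g - 1) =
      (laurentMonomial μ (D.abelianization g) - algebraMap ℂ (RatFn μ) z) *
        (laurentMonomial μ (D.abelianization g) - algebraMap ℂ (RatFn μ) z⁻¹) := by
  rw [twistedEnd_eq, Module.End.one_eq_id, ← Matrix.toLin'_one, ← map_sub, LinearMap.det_toLin']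
  change (laurentMonomial μ (D.abelianization g) •
    (ρ g : Matrix (Fin 2) (Fin 2) ℂ).map (algebraMap ℂ (RatFn μ)) - 1).det = _
  have hdet := (ρ g).det_coe
  generalize (ρ g : Matrix (Fin 2) (Fin 2) ℂ) = B at h hdet
  rw [Matrix.det_fin_two] at hdet
  rw [Matrix.trace_fin_two] at h
  have hdet' := congrArg (algebraMap ℂ (RatFn μ)) hdet
  have h' := congrArg (algebraMap ℂ (RatFn μ)) h
  have hz' : algebraMap ℂ (RatFn μ) z * algebraMap ℂ (RatFn μ) z⁻¹ = 1 := by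
    rw [← map_mul, mul_inv_cancel₀ hz, map_one]
  simp only [map_sub, map_mul, map_add, map_one] at hdet' h'
  rw [Matrix.det_fin_two]
  simp only [Matrix.sub_apply, Matrix.smul_apply, Matrix.map_apply, smul_eq_mul,
    Matrix.one_apply_eq, Matrix.one_apply_ne (show (0 : Fin 2) ≠ 1 by decide),
    Matrix.one_apply_ne (show (1 : Fin 2) ≠ 0 by decide), sub_zero]
  linear_combination (laurentMonomial μ (D.abelianization g)) ^ 2 * hdet' -
    laurentMonomial μ (D.abelianization g) * h' - hz'

lemma twistedEnd_pow (g : D.linkGroup) (N : ℕ) {c : ℂ}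
    (h : (ρ g : Matrix (Fin 2) (Fin 2) ℂ) ^ N = c • 1) :
    D.twistedEnd ρ g ^ N = (laurentMonomial μ (D.abelianization g) ^ N *
      algebraMap ℂ (RatFn μ) c) • (1 : Module.End (RatFn μ) (Fin 2 → RatFn μ)) := by
  rw [← map_pow, twistedEnd_eq]
  have h1 : D.tensorRep ρ (g ^ N) =
      (laurentMonomial μ (D.abelianization g) ^ N * algebraMap ℂ (RatFn μ) c) • 1 := by
    change laurentMonomial μ (D.abelianization (g ^ N)) •
      (ρ (g ^ N) : Matrix (Fin 2) (Fin 2) ℂ).map (algebraMap ℂ (RatFn μ)) = _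
    rw [map_pow, map_pow, map_pow, Matrix.SpecialLinearGroup.coe_pow, h, mul_smul]
    congr 1
    ext i j
    by_cases hij : i = j
    · subst hij; simp
    · simp [hij]
  rw [h1, map_smul, Matrix.toLin'_one]
  rfl

variable [Fintype A] [DecidableEq A]

/-- The value on a word `w` of the twisted derivation which takes the value `δ a` at the generator
`a`; as a function of `δ` it is the row of Fox derivatives of `w`. -/
def foxEval (w : FreeGroup A) : (A → Fin 2 → RatFn μ) →ₗ[RatFn μ] (Fin 2 → RatFn μ) :=
  ∑ a, Matrix.toLin' (D.Phi ρ (foxDeriv a w)) ∘ₗ LinearMap.proj a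

lemma foxEval_apply (w : FreeGroup A) (δ : A → Fin 2 → RatFn μ) :
    D.foxEval ρ w δ = ∑ a, D.Phi ρ (foxDeriv a w) *ᵥ δ a := by
  simp [foxEval, LinearMap.sum_apply]

lemma foxEval_of (i : A) (δ : A → Fin 2 → RatFn μ) :
    D.foxEval ρ (FreeGroup.of i) δ = δ i := by
  rw [foxEval_apply, Finset.sum_eq_single i]
  · simp [foxDeriv_of]
  · intro a _ ha
    simp [foxDeriv_of, ha.symm]
  · simp

lemma foxEval_mul (u w : FreeGroup A) (δ : A → Fin 2 → RatFn μ) :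
    D.foxEval ρ (u * w) δ = D.foxEval ρ u δ +
      D.twistedEnd ρ (PresentedGroup.mk _ u) (D.foxEval ρ w δ) := by
  simp only [foxEval_apply, foxDeriv_mul, map_add, map_mul, Phi_of, Matrix.add_mulVec,
    Finset.sum_add_distrib, map_sum, twistedEnd_apply, Matrix.mulVec_mulVec]

lemma foxEval_one (δ : A → Fin 2 → RatFn μ) : D.foxEval ρ 1 δ = 0 := by
  simpa using D.foxEval_mul ρ 1 1 δ

lemma foxEval_inv (u : FreeGroup A) (δ : A → Fin 2 → RatFn μ) :
    D.foxEval ρ u⁻¹ δ = - D.twistedEnd ρ (PresentedGroup.mk _ u)⁻¹ (D.foxEval ρ u δ) := by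
  have h := D.foxEval_mul ρ u⁻¹ u δ
  rw [inv_mul_cancel, foxEval_one, map_inv] at h
  exact eq_neg_of_add_eq_zero_left h.symm

/-- The fundamental formula of the free differential calculus. -/
lemma foxEval_sub_one (w : FreeGroup A) (x : Fin 2 → RatFn μ) :
    D.foxEval ρ w (fun a => (D.twistedEnd ρ (D.meridian a) - 1) x) =
      (D.twistedEnd ρ (PresentedGroup.mk _ w) - 1) x := by
  induction w using FreeGroup.induction_on with
  | C1 => simp [foxEval_one]
  | of i => rw [foxEval_of]; rfl
  | inv_of i ih =>
    rw [foxEval_inv, ih, LinearMap.sub_apply, map_sub, ← Module.End.mul_apply, ← map_mul,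
      inv_mul_cancel, map_inv (PresentedGroup.mk _)]
    simp
  | mul u v hu hv =>
    rw [foxEval_mul, hu, hv, map_mul, map_mul]
    simp

lemma foxEval_relator_sub_one (c : C) (x : Fin 2 → RatFn μ) :
    D.foxEval ρ (D.relator c) (fun a => (D.twistedEnd ρ (D.meridian a) - 1) x) = 0 := by
  rw [foxEval_sub_one, show PresentedGroup.mk (Set.range D.relator) (D.relator c) = 1 from
    PresentedGroup.one_of_mem ⟨c, rfl⟩, map_one, sub_self, LinearMap.zero_apply]

lemma foxEval_relator (c : C) (hc : D.sign c = 1) (δ : A → Fin 2 → RatFn μ) :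
    D.foxEval ρ (D.relator c) δ = δ (D.overArc c) -
      D.twistedEnd ρ (D.meridian (D.inArc c)) (δ (D.overArc c)) +
      D.twistedEnd ρ (D.meridian (D.overArc c)) (δ (D.outArc c)) - δ (D.inArc c) := by
  have hw := D.wirtinger_relation c
  rw [hc, Units.val_one, zpow_one] at hw
  have hm : ∀ a, PresentedGroup.mk (Set.range D.relator) (FreeGroup.of a) = D.meridian a :=
    fun _ => rfl
  rw [relator, hc, Units.val_one, zpow_one]
  simp only [foxEval_mul, foxEval_inv, foxEval_of, map_mul, map_inv, map_neg, hm]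
  rw [← Module.End.mul_apply, ← Module.End.mul_apply, ← map_mul, ← map_mul, ← map_mul, hw, mul_inv_cancel_right, mul_inv_cancel, map_one, Module.End.one_apply]
  abel

/-- The Alexander matrix with a column removed, as a linear map. -/
def alexanderMap (j : A) (r : {i : A // i ≠ j} ↪ C) :
    ({i : A // i ≠ j} → Fin 2 → RatFn μ) →ₗ[RatFn μ] ({i : A // i ≠ j} → Fin 2 → RatFn μ) :=
  (LinearEquiv.curry (RatFn μ) (RatFn μ) {i : A // i ≠ j} (Fin 2) : _ →ₗ[RatFn μ] _) ∘ₗ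
    Matrix.toLin' (D.alexanderMatrix ρ j r) ∘ₗ
      ((LinearEquiv.curry (RatFn μ) (RatFn μ) {i : A // i ≠ j} (Fin 2)).symm : _ →ₗ[RatFn μ] _)

lemma det_alexanderMap (j : A) (r : {i : A // i ≠ j} ↪ C) :
    LinearMap.det (D.alexanderMap ρ j r) = (D.alexanderMatrix ρ j r).det := by
  rw [alexanderMap, LinearMap.det_conj, LinearMap.det_toLin']

lemma alexanderMap_apply (j : A) (r : {i : A // i ≠ j} ↪ C) (δ : A → Fin 2 → RatFn μ)
    (hδ : δ j = 0) (i : {i : A // i ≠ j}) :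
    D.alexanderMap ρ j r (fun a => δ a) i = D.foxEval ρ (D.relator (r i)) δ := by
  funext ε
  rw [foxEval_apply, Fintype.sum_eq_add_sum_subtype_ne _ j, hδ, Matrix.mulVec_zero, zero_add,
    Finset.sum_apply]
  change (D.alexanderMatrix ρ j r *ᵥ fun x => δ x.1 x.2) (i, ε) = _
  rw [Matrix.mulVec, dotProduct, Fintype.sum_prod_type]
  rfl

end LinkDiagram

/-! ### The cores in the abelianization -/

section CoreClasses

lemma cycProd_zero_eq_prod {M : Type*} [CommMonoid M] {m : ℕ} [NeZero m] (g : Fin m → M) (N : ℕ) :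
    cycProd g 0 N = ∏ i ∈ Finset.range N, g (i • 1) := by
  induction N with
  | zero => simp
  | succ N ih => rw [cycProd_succ', ih, Finset.prod_range_succ, zero_add]

variable (μ p q : ℕ) [NeZero μ] [NeZero p] [NeZero q] (hpq : p.Coprime q)

lemma laurentMonomial_torusMeridian (k : Fin (μ * q)) :
    laurentMonomial μ ((torusLinkDiagram μ p q hpq).abelianization (torusMeridian μ p q hpq k 0)) =
      tVar ⟨(k : ℕ) % μ, Nat.mod_lt _ (NeZero.pos μ)⟩ := by
  have h1 : torusMeridian μ p q hpq k 0 =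
      (torusLinkDiagram μ p q hpq).meridian (torusStrand (μ * p) (μ * q) k 0) :=
    (torusMeridian_of_lt μ p q hpq k 0).symm
  have h2 : torusComponent μ p q (torusStrand (μ * p) (μ * q) k 0) =
      ⟨(k : ℕ) % μ, Nat.mod_lt _ (NeZero.pos μ)⟩ := by
    apply Fin.ext
    rw [torusComponent_strand, Fin.val_zero, add_zero]
  rw [h1, LinkDiagram.laurentMonomial_meridian, ← h2]
  rfl

lemma laurentMonomial_cycProd (N : ℕ) :
    laurentMonomial μ ((torusLinkDiagram μ p q hpq).abelianization
      (cycProd (fun k => torusMeridian μ p q hpq k 0) 0 (μ * N))) = tProd μ ^ N := by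
  rw [map_cycProd, map_cycProd, cycProd_zero_eq_prod]
  simp only [laurentMonomial_torusMeridian, val_nsmul_one', Nat.mod_mul_right_mod]
  induction N with
  | zero => simp
  | succ N ih =>
    rw [Nat.mul_succ, Finset.prod_range_add, ih, pow_succ, tProd]
    congr 1
    rw [Finset.prod_range]
    refine Finset.prod_congr rfl fun i _ => ?_
    congr 1
    apply Fin.ext
    simp [Nat.mod_eq_of_lt i.2]

lemma laurentMonomial_coreX : laurentMonomial μ
    ((torusLinkDiagram μ p q hpq).abelianization (torusCoreX μ p q hpq)) = tProd μ ^ q := by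
  rw [torusCoreX_eq, laurentMonomial_cycProd]

lemma laurentMonomial_coreY : laurentMonomial μ
    ((torusLinkDiagram μ p q hpq).abelianization (torusCoreY μ p q hpq)) = tProd μ ^ p := by
  rw [torusCoreY_eq, laurentMonomial_cycProd]

end CoreClasses

section Transcendence

lemma tVar_ne_algebraMap {μ : ℕ} (i : Fin μ) (z : ℂ) : tVar i ≠ algebraMap ℂ (RatFn μ) z := by
  rw [tVar, IsScalarTower.algebraMap_apply ℂ (MvPolynomial (Fin μ) ℂ) (RatFn μ)]
  intro h
  have h1 := IsFractionRing.injective (MvPolynomial (Fin μ) ℂ) (RatFn μ) h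
  rw [MvPolynomial.algebraMap_eq] at h1
  have h2 := congrArg (MvPolynomial.eval (fun _ => z + 1)) h1
  simp at h2

lemma tProd_pow_ne_algebraMap {μ : ℕ} [NeZero μ] (N : ℕ) [NeZero N] (z : ℂ) :
    tProd μ ^ N ≠ algebraMap ℂ (RatFn μ) z := by
  simp only [tProd, tVar]
  rw [IsScalarTower.algebraMap_apply ℂ (MvPolynomial (Fin μ) ℂ) (RatFn μ), ← map_prod, ← map_pow]
  intro h
  have h1 := IsFractionRing.injective (MvPolynomial (Fin μ) ℂ) (RatFn μ) h
  rw [MvPolynomial.algebraMap_eq] at h1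
  have h2 := congrArg (MvPolynomial.eval (fun _ => (1 : ℂ))) h1
  have h3 := congrArg (MvPolynomial.eval (fun _ => (0 : ℂ))) h1
  simp at h2
  simp [NeZero.ne N, NeZero.ne μ] at h3
  rw [← h2] at h3
  exact zero_ne_one h3

end Transcendence

/-! ### The twisted Alexander polynomial of a torus link -/

section TorusAlexander

/-- The arcs of a torus link diagram with at least two strands are named by the crossings. -/
def crossingEquivArc (n m : ℕ) [NeZero m] (hn : 2 ≤ n) : TorusCrossing n m ≃ TorusArc n m where
  toFun c := ⟨c.1, Or.inl c.2⟩
  invFun a := ⟨a.1, a.2.resolve_right fun h => by omega⟩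
  left_inv _ := rfl
  right_inv _ := rfl

lemma apply_torusStrand {K V : Type*} [Field K] [AddCommGroup V] [Module K V] {n m : ℕ} [NeZero n]
    [NeZero m] (hn : 2 ≤ n) (η : TorusCrossing n m → V) (k : Fin m) (i : Fin n) :
    η ((crossingEquivArc n m hn).symm (torusStrand n m k i)) = strandValue K V m n hn k i η := by
  by_cases h : (i : ℕ) + 1 < n
  · rw [strandValue_of_lt hn h]
    simp only [torusStrand, dif_pos h]
    rfl
  · rw [strandValue, dif_neg h]
    simp only [torusStrand, dif_neg h, dif_neg (show n ≠ 1 by omega)]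
    rfl

/-- An enumeration of all crossings but one by the arcs other than `j` extends to a bijection. -/
lemma exists_equiv_extending {A C : Type} [Fintype A] [Fintype C] [DecidableEq A]
    (hAC : Fintype.card A = Fintype.card C) (j : A) (r : {i : A // i ≠ j} ↪ C) :
    ∃ e : A ≃ C, ∀ i : {i : A // i ≠ j}, e i = r i := by
  classical
  obtain ⟨c, hc⟩ : ∃ c, c ∉ Set.range r := by
    by_contra! h
    have h1 := Fintype.card_le_of_surjective r h
    have h2 : Fintype.card {i : A // i ≠ j} < Fintype.card A :=
      Fintype.card_subtype_lt (x := j) (by simp)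
    omega
  let f : A → C := fun a => if h : a = j then c else r ⟨a, h⟩
  have hf : Function.Injective f := by
    intro a b hab
    by_cases ha : a = j <;> by_cases hb : b = j
    · rw [ha, hb]
    · simp only [f, dif_pos ha, dif_neg hb] at hab
      exact absurd ⟨_, hab.symm⟩ hc
    · simp only [f, dif_neg ha, dif_pos hb] at hab
      exact absurd ⟨_, hab⟩ hc
    · simp only [f, dif_neg ha, dif_neg hb] at hab
      exact congrArg Subtype.val (r.injective hab)
  refine ⟨Equiv.ofBijective f ((Fintype.bijective_iff_injective_and_card f).2 ⟨hf, hAC⟩), ?_⟩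
  rintro ⟨i, hi⟩
  exact dif_neg hi

lemma sum_cycProd_sub_one {K V : Type*} [Field K] [AddCommGroup V] [Module K V] {m : ℕ} [NeZero m]
    (g : Fin m → Module.End K V) (k : Fin m) (N : ℕ) (w : V) :
    ∑ i ∈ Finset.range N, cycProd g k i ((g (k + i • 1) - 1) w) = (cycProd g k N - 1) w := by
  induction N with
  | zero => simp
  | succ N ih =>
    rw [Finset.sum_range_succ, ih, cycProd_succ']
    simp

variable (μ p q : ℕ) [NeZero μ] [NeZero p] [NeZero q] (hpq : p.Coprime q)

/-- The twisted Alexander polynomial, multiplied by the determinants at the cores. The element `g`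
depends only on the crossing whose relator is omitted: it is the coefficient of this relator in the
relation between the relators. -/
theorem exists_twistedAlexander_mul (hn : 2 ≤ μ * p) (j : TorusArc (μ * p) (μ * q))
    (r : {i : TorusArc (μ * p) (μ * q) // i ≠ j} ↪ TorusCrossing (μ * p) (μ * q)) :
    ∃ g : (torusLinkDiagram μ p q hpq).linkGroup,
      ∀ (ρ : (torusLinkDiagram μ p q hpq).linkGroup →* SL2C) (c : RatFn μ),
      (torusLinkDiagram μ p q hpq).twistedEnd ρ (torusCoreY μ p q hpq) ^ q =
        c • (1 : Module.End (RatFn μ) (Fin 2 → RatFn μ)) →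
      (torusLinkDiagram μ p q hpq).twistedAlexander ρ j r *
        LinearMap.det ((torusLinkDiagram μ p q hpq).twistedEnd ρ (torusCoreX μ p q hpq) - 1) *
        LinearMap.det ((torusLinkDiagram μ p q hpq).twistedEnd ρ (torusCoreY μ p q hpq) - 1) =
      LinearMap.det ((torusLinkDiagram μ p q hpq).twistedEnd ρ g) * (c - 1) ^ (2 * μ) := by
  set D := torusLinkDiagram μ p q hpq with hD
  let ε := crossingEquivArc (μ * p) (μ * q) hn
  obtain ⟨e, he⟩ := exists_equiv_extending (Fintype.card_congr ε).symm j r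
  obtain ⟨k₀, i₀, h₀, hc₀⟩ := exists_eq_torusCrossing (e j)
  refine ⟨cycProd (fun k => torusMeridian μ p q hpq k 0) (k₀ - (μ * p - 2 - i₀) • 1)
    (μ * p - 2 - i₀), fun ρ c hc => ?_⟩
  let s : Fin (μ * q) → ℕ → Module.End (RatFn μ) (Fin 2 → RatFn μ) :=
    fun k i => D.twistedEnd ρ (torusMeridian μ p q hpq k i)
  have hs : IsTorusFamily (μ * p) s := (isTorusFamily_torusMeridian μ p q hpq).map (D.twistedEnd ρ)
  have hV : Even (Module.finrank (RatFn μ) (Fin 2 → RatFn μ)) := by simp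
  have hsX : cycProd (fun k => s k 0) 0 (μ * q) = D.twistedEnd ρ (torusCoreX μ p q hpq) := by
    rw [torusCoreX_eq, map_cycProd]
  have hsY : ∀ k, cycProd (fun k => s k 0) k (μ * p) = D.twistedEnd ρ (torusCoreY μ p q hpq) := by
    intro k
    rw [hs.cycProd_eq (NeZero.pos _), torusCoreY_eq, map_cycProd]
  -- the operator `1 + T + ⋯ + T ^ (n - 1)` of the weighted cyclic shift `T`
  let T := cycShift (fun k => s k 0)
  have hT : LinearMap.det (∑ i ∈ Finset.range (μ * p), T ^ i) *
      LinearMap.det (D.twistedEnd ρ (torusCoreX μ p q hpq) - 1) = (c - 1) ^ (2 * μ) := by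
    rw [← hsX, ← det_cycShift_sub_one hV, ← map_mul, geom_sum_mul, det_shift_sub_one hpq hV _ c hc]
    · simp [mul_comm]
    · intro d k
      rw [cycShift_pow_apply, hsY]
  have hsmer : ∀ k (i : Fin (μ * p)), D.twistedEnd ρ (D.meridian (torusStrand _ _ k i)) = s k i :=
    fun k i => by rw [torusMeridian_of_lt]
  let k' := k₀ - (μ * p - 2 - i₀) • 1
  -- the Alexander matrix with a row added for the core `y`
  let z : (TorusArc (μ * p) (μ * q) → Fin 2 → RatFn μ) →ₗ[RatFn μ] (Fin 2 → RatFn μ) :=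
    coreRow hn s k' ∘ₗ LinearMap.funLeft _ _ ε
  let L : (TorusArc (μ * p) (μ * q) → Fin 2 → RatFn μ) →ₗ[RatFn μ]
      (TorusArc (μ * p) (μ * q) → Fin 2 → RatFn μ) :=
    LinearMap.pi fun a => if a = j then z else D.foxEval ρ (D.relator (e a))
  have h1 := det_addRow_mul_det j
    (LinearMap.pi fun i : {i // i ≠ j} => D.foxEval ρ (D.relator (r i))) z
    (fun a => D.twistedEnd ρ (D.meridian a) - 1)
    (fun w => funext fun i => D.foxEval_relator_sub_one ρ (r i) w)
    (D.alexanderMap ρ j r)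
    (fun δ hδ => funext fun i => (D.alexanderMap_apply ρ j r δ hδ i).symm)
    (D.twistedEnd ρ (torusCoreY μ p q hpq) - 1)
    (fun w => by
      rw [← hsY k', ← sum_cycProd_sub_one]
      change coreRow hn s k' (fun x => _) = _
      rw [coreRow_apply]
      refine Finset.sum_congr rfl fun i _ => ?_
      congr 1
      have h2 := apply_torusStrand (K := RatFn μ) hn
        (fun x => (D.twistedEnd ρ (D.meridian (ε x)) - 1) w) (k' + i • 1) 0
      rw [Fin.val_zero] at h2
      refine Eq.trans h2.symm ?_
      simp only [ε, Equiv.apply_symm_apply, hsmer, Fin.val_zero])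
    L (fun δ => by simp [L]) (fun δ i => by simp [L, i.2, he])
  -- the same matrix with rows and columns named by crossings
  let L' : (TorusCrossing (μ * p) (μ * q) → Fin 2 → RatFn μ) →ₗ[RatFn μ]
      (TorusCrossing (μ * p) (μ * q) → Fin 2 → RatFn μ) :=
    LinearMap.funLeft _ _ e.symm ∘ₗ L ∘ₗ LinearMap.funLeft _ _ ε.symm
  have hLL' : LinearMap.det L' = LinearMap.det L := by
    rw [← det_comp_funLeft hV (ε.symm.trans e.symm) L,
      ← LinearMap.det_conj L' (LinearEquiv.funCongrLeft (RatFn μ) (Fin 2 → RatFn μ) ε.symm)]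
    congr 1
  have h2 : LinearMap.det L' = _ := det_coreRow_replace hn hV hs k₀ i₀ h₀ L'
    (fun δ => by
      change L (fun a => δ (ε.symm a)) (e.symm (torusCrossing k₀ i₀ h₀)) = _
      rw [← hc₀, Equiv.symm_apply_apply]
      simp only [L, LinearMap.pi_apply, if_true]
      change coreRow hn s k' (fun x => δ (ε.symm (ε x))) = _
      simp only [Equiv.symm_apply_apply]
      rfl)
    (fun δ k i hi hne => by
      change L (fun a => δ (ε.symm a)) (e.symm (torusCrossing k i hi)) = _
      have h3 : e.symm (torusCrossing k i hi) ≠ j := by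
        rw [Ne, Equiv.symm_apply_eq, hc₀]
        exact hne
      have hi1 : ((torusCrossing k i hi).1.2 + 1 : Fin (μ * p)) = ⟨i + 1, hi⟩ :=
        fin_succ_eq_mk _ hi
      simp only [L, LinearMap.pi_apply, if_neg h3, Equiv.apply_symm_apply]
      rw [D.foxEval_relator ρ _ rfl, relatorRow_apply]
      change δ (ε.symm (torusStrand _ _ k 0)) -
        D.twistedEnd ρ (D.meridian (torusStrand _ _ k ((torusCrossing k i hi).1.2 + 1)))
          (δ (ε.symm (torusStrand _ _ k 0))) +
        D.twistedEnd ρ (D.meridian (torusStrand _ _ k 0))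
          (δ (ε.symm (torusStrand _ _ (k + 1) ⟨i, by omega⟩))) -
        δ (ε.symm (torusStrand _ _ k ((torusCrossing k i hi).1.2 + 1))) = _
      rw [hi1, hsmer, hsmer, apply_torusStrand (K := RatFn μ) hn δ,
        apply_torusStrand (K := RatFn μ) hn δ, apply_torusStrand (K := RatFn μ) hn δ,
        Fin.val_zero])
  rw [LinkDiagram.det_alexanderMap, ← hLL', h2] at h1
  have hvj : D.twistedAlexander ρ j r = (D.alexanderMatrix ρ j r).det /
      LinearMap.det (D.twistedEnd ρ (D.meridian j) - 1) := by
    rw [LinkDiagram.twistedAlexander, map_sub, LinkDiagram.Phi_of, map_one,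
      LinkDiagram.twistedEnd_eq, Module.End.one_eq_id, ← Matrix.toLin'_one, ← map_sub,
      LinearMap.det_toLin']
    rfl
  have hvj0 : LinearMap.det (D.twistedEnd ρ (D.meridian j) - 1) ≠ 0 := by
    obtain ⟨y, hy⟩ := Module.End.exists_eigenvalue
      (Matrix.toLin' (ρ (D.meridian j) : Matrix (Fin 2) (Fin 2) ℂ))
    obtain ⟨hy0, htr⟩ := SL2C.ne_zero_and_trace_of_hasEigenvalue _ hy
    rw [D.det_twistedEnd_sub_one ρ _ hy0 htr]
    rw [LinkDiagram.laurentMonomial_meridian]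
    exact mul_ne_zero (sub_ne_zero.2 (tVar_ne_algebraMap _ _))
      (sub_ne_zero.2 (tVar_ne_algebraMap _ _))
  rw [hvj, map_cycProd, ← hT, ← mul_assoc]
  rw [div_mul_eq_mul_div, div_mul_eq_mul_div, div_eq_iff hvj0, mul_right_comm, ← h1]
  ring

end TorusAlexander

/-! ### Laurent polynomials and local constancy -/

section Divisibility

open Polynomial in
lemma pow_sub_dvd {p q : ℕ} {z ε : ℂ} (h : z ^ q = ε) :
    (X ^ p - C z : ℂ[X]) ∣ X ^ (p * q) - C ε := by
  rw [← h, pow_mul, C_pow]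
  exact sub_dvd_pow_sub_pow _ _ _

open Polynomial in
lemma isCoprime_pow_sub {p : ℕ} {z w : ℂ} (h : z ≠ w) :
    IsCoprime (X ^ p - C z : ℂ[X]) (X ^ p - C w) := by
  refine ⟨-C (z - w)⁻¹, C (z - w)⁻¹, ?_⟩
  have h1 : C (z - w)⁻¹ * (C z - C w) = (1 : ℂ[X]) := by
    rw [← C_sub, ← C_mul, inv_mul_cancel₀ (sub_ne_zero.2 h), C_1]
  linear_combination h1

end Divisibility

section LocallyConstant

lemma isLocallyConstant_of_finite_range {X Y : Type*} [TopologicalSpace X] [TopologicalSpace Y]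
    [T1Space Y] {f : X → Y} (hf : Continuous f) (hr : (Set.range f).Finite) :
    IsLocallyConstant f := by
  have : Finite (Set.range f) := hr
  have h1 : Continuous (Set.rangeFactorization f) := hf.subtype_mk _
  exact ((IsLocallyConstant.iff_continuous _).2 h1).comp Subtype.val

/-- The trace of the image of a group element, as a function on the character variety. -/
def charTrace {G : Type} [Group G] (g : G) : IrrCharVariety G → ℂ :=
  Quotient.lift (fun ρ : IrrRep G => (ρ.1 g : Matrix (Fin 2) (Fin 2) ℂ).trace) (by
    rintro ρ ρ' ⟨S, h⟩
    simp only [h g, Matrix.SpecialLinearGroup.coe_mul]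
    rw [Matrix.trace_mul_comm, ← mul_assoc, ← Matrix.SpecialLinearGroup.coe_mul, inv_mul_cancel,
      Matrix.SpecialLinearGroup.coe_one, one_mul])

lemma continuous_charTrace {G : Type} [Group G] (g : G) : Continuous (charTrace g) := by
  refine Continuous.quotient_lift ?_ _
  have h1 : Continuous fun ρ : IrrRep G => ρ.1 g :=
    (continuous_apply g).comp continuous_induced_dom
  exact (continuous_subtype_val.comp h1).matrix_trace

end LocallyConstant

section Formula

lemma laurentToRat_single {μ : ℕ} (e : Fin μ → ℤ) :
    laurentToRat μ (AddMonoidAlgebra.single e 1) = ∏ i, tVar i ^ e i := by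
  rw [laurentToRat, AddMonoidAlgebra.lift_single, one_smul]
  rfl

variable {μ p q : ℕ} [NeZero μ] [NeZero p] [NeZero q] {hpq : p.Coprime q}

lemma core_pow_eq (ρ : IrrRep (torusLinkDiagram μ p q hpq).linkGroup) {a b : ℕ}
    (hX : (ρ.1 (torusCoreX μ p q hpq) : Matrix (Fin 2) (Fin 2) ℂ).trace =
      rootExp a p + (rootExp a p)⁻¹)
    (hY : (ρ.1 (torusCoreY μ p q hpq) : Matrix (Fin 2) (Fin 2) ℂ).trace =
      rootExp b q + (rootExp b q)⁻¹) :
    (ρ.1 (torusCoreY μ p q hpq) : Matrix (Fin 2) (Fin 2) ℂ) ^ q = ((-1) ^ a : ℂ) • 1 ∧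
      (rootExp b q) ^ q = (-1) ^ a := by
  obtain ⟨c, h1, h2⟩ := exists_core_pow_eq_smul ρ
  have h3 := SL2C.pow_eq_of_hasEigenvalue _
    (SL2C.hasEigenvalue_of_trace _ (rootExp_ne_zero a p) hX) h1
  have h4 := SL2C.pow_eq_of_hasEigenvalue _
    (SL2C.hasEigenvalue_of_trace _ (rootExp_ne_zero b q) hY) h2
  rw [rootExp_pow] at h3
  exact ⟨h3 ▸ h2, by rw [← h4, h3]⟩

/-- The group of the unknot, as that of `T(1, q)`, has no irreducible representations. -/
lemma two_le_of_irrRep (ρ : IrrRep (torusLinkDiagram μ p q hpq).linkGroup) : 2 ≤ μ * p := by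
  by_contra h
  have h1 : 0 < μ * p := NeZero.pos _
  have hμ : μ = 1 := Nat.eq_one_of_mul_eq_one_right (by omega : μ * p = 1)
  have hp : p = 1 := Nat.eq_one_of_mul_eq_one_left (by omega : μ * p = 1)
  obtain ⟨c, h2, -⟩ := exists_core_pow_eq_smul ρ
  refine (core_ne_smul_one ρ hμ c).1 ?_
  have h3 : ∀ B : Matrix (Fin 2) (Fin 2) ℂ, B ^ p = c • 1 → B = c • 1 := fun B hB => by
    rwa [hp, pow_one] at hB
  exact h3 _ h2

/-- The twisted Alexander polynomial of a representation, in terms of the traces at the cores. -/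
theorem exists_twistedAlexander_eq (j : TorusArc (μ * p) (μ * q))
    (r : {i : TorusArc (μ * p) (μ * q) // i ≠ j} ↪ TorusCrossing (μ * p) (μ * q)) :
    ∃ k : Fin μ → ℤ, ∀ (ρ : IrrRep (torusLinkDiagram μ p q hpq).linkGroup) (a b : ℕ),
      (ρ.1 (torusCoreX μ p q hpq) : Matrix (Fin 2) (Fin 2) ℂ).trace =
        rootExp a p + (rootExp a p)⁻¹ →
      (ρ.1 (torusCoreY μ p q hpq) : Matrix (Fin 2) (Fin 2) ℂ).trace =
        rootExp b q + (rootExp b q)⁻¹ →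
      (torusLinkDiagram μ p q hpq).twistedAlexander ρ.1 j r =
        (∏ i, tVar i ^ (2 * k i)) *
          ((tProd μ ^ (p * q) - (-1) ^ a) ^ (2 * μ) /
            ((tProd μ ^ p - algebraMap ℂ (RatFn μ) (rootExp b q)) *
              (tProd μ ^ p - algebraMap ℂ (RatFn μ) (rootExp b q)⁻¹) *
              (tProd μ ^ q - algebraMap ℂ (RatFn μ) (rootExp a p)) *
              (tProd μ ^ q - algebraMap ℂ (RatFn μ) (rootExp a p)⁻¹))) := by
  by_cases hn : 2 ≤ μ * p
  swap
  · exact ⟨0, fun ρ => absurd (two_le_of_irrRep ρ) hn⟩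
  obtain ⟨g, hg⟩ := exists_twistedAlexander_mul μ p q hpq hn j r
  refine ⟨Multiplicative.toAdd ((torusLinkDiagram μ p q hpq).abelianization g),
    fun ρ a b hX hY => ?_⟩
  have h1 := hg ρ.1 _ (LinkDiagram.twistedEnd_pow _ _ _ q (core_pow_eq ρ hX hY).1)
  rw [LinkDiagram.det_twistedEnd_sub_one _ _ _ (rootExp_ne_zero a p) hX,
    LinkDiagram.det_twistedEnd_sub_one _ _ _ (rootExp_ne_zero b q) hY, laurentMonomial_coreX,
    laurentMonomial_coreY, LinkDiagram.det_twistedEnd, ← pow_mul] at h1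
  have h2 : laurentMonomial μ ((torusLinkDiagram μ p q hpq).abelianization g) ^ 2 =
      ∏ i, tVar i ^ (2 * Multiplicative.toAdd
        ((torusLinkDiagram μ p q hpq).abelianization g) i) := by
    change (∏ i, tVar i ^ (Multiplicative.toAdd
      ((torusLinkDiagram μ p q hpq).abelianization g) i)) ^ 2 = _
    rw [← Finset.prod_pow]
    have hz : ∀ (x : RatFn μ) (e : ℤ), (x ^ e) ^ 2 = x ^ (2 * e) := fun x e => by
      rw [mul_comm, zpow_mul]
      rfl
    exact Finset.prod_congr rfl fun i _ => hz _ _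
  have h3 : (tProd μ ^ (p * q) * algebraMap ℂ (RatFn μ) ((-1) ^ a) - 1) ^ (2 * μ) =
      (tProd μ ^ (p * q) - (-1) ^ a) ^ (2 * μ) := by
    rw [map_pow, map_neg, map_one, pow_mul, pow_mul _ 2 μ]
    congr 1
    rcases neg_one_pow_eq_or (RatFn μ) a with h | h <;> rw [h] <;> ring
  rw [h2, h3] at h1
  have hd : ∀ (N : ℕ) [NeZero N] (z : ℂ), tProd μ ^ N - algebraMap ℂ (RatFn μ) z ≠ 0 :=
    fun N _ z => sub_ne_zero.2 (tProd_pow_ne_algebraMap N z)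
  rw [← mul_div_assoc, eq_div_iff (mul_ne_zero (mul_ne_zero (mul_ne_zero (hd _ _) (hd _ _))
    (hd _ _)) (hd _ _)), ← h1]
  ring

open Polynomial in
/-- The quotient in the formula for the twisted Alexander polynomial is a polynomial. For links with
at least two components each of the four factors of the denominator divides `t^{pq} - (-1)^a`; for
knots the factors with inverse constants are moreover coprime. -/
lemma denominator_dvd (ρ : IrrRep (torusLinkDiagram μ p q hpq).linkGroup) {a b : ℕ}
    (hX : (ρ.1 (torusCoreX μ p q hpq) : Matrix (Fin 2) (Fin 2) ℂ).trace =
      rootExp a p + (rootExp a p)⁻¹)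
    (hY : (ρ.1 (torusCoreY μ p q hpq) : Matrix (Fin 2) (Fin 2) ℂ).trace =
      rootExp b q + (rootExp b q)⁻¹) :
    (X ^ p - C (rootExp b q)) * (X ^ p - C (rootExp b q)⁻¹) * (X ^ q - C (rootExp a p)) *
      (X ^ q - C (rootExp a p)⁻¹) ∣ (X ^ (p * q) - C ((-1) ^ a) : ℂ[X]) ^ (2 * μ) := by
  have hb := (core_pow_eq ρ hX hY).2
  have hinv : ((-1 : ℂ) ^ a)⁻¹ = (-1) ^ a := by
    rcases neg_one_pow_eq_or ℂ a with h | h <;> rw [h] <;> norm_num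
  have d1 : (X ^ p - C (rootExp b q) : ℂ[X]) ∣ X ^ (p * q) - C ((-1) ^ a) := pow_sub_dvd hb
  have d2 : (X ^ p - C (rootExp b q)⁻¹ : ℂ[X]) ∣ X ^ (p * q) - C ((-1) ^ a) :=
    pow_sub_dvd (by rw [inv_pow, hb, hinv])
  have d3 : (X ^ q - C (rootExp a p) : ℂ[X]) ∣ X ^ (p * q) - C ((-1) ^ a) := by
    rw [mul_comm p q]; exact pow_sub_dvd (rootExp_pow a p)
  have d4 : (X ^ q - C (rootExp a p)⁻¹ : ℂ[X]) ∣ X ^ (p * q) - C ((-1) ^ a) := by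
    rw [mul_comm p q]; exact pow_sub_dvd (by rw [inv_pow, rootExp_pow, hinv])
  by_cases hμ : μ = 1
  · have key : ∀ (A : SL2C) (N : ℕ) (c z : ℂ), N ≠ 0 → z ≠ 0 →
        (A : Matrix (Fin 2) (Fin 2) ℂ).trace = z + z⁻¹ →
        (A : Matrix (Fin 2) (Fin 2) ℂ) ^ N = c • 1 → (A : Matrix (Fin 2) (Fin 2) ℂ) ≠ z • 1 →
        z ≠ z⁻¹ := fun A N c z hN hz htr hc hA hzz =>
      hA (SL2C.eq_smul_one_of_pow A hN (by nth_rw 2 [hzz]; exact mul_inv_cancel₀ hz)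
        (by rw [htr, ← hzz]) hc)
    obtain ⟨c, h1, h2⟩ := exists_core_pow_eq_smul ρ
    have hα := key _ p c _ (NeZero.ne p) (rootExp_ne_zero a p) hX h1
      (core_ne_smul_one ρ hμ _).1
    have hβ := key _ q c _ (NeZero.ne q) (rootExp_ne_zero b q) hY h2
      (core_ne_smul_one ρ hμ _).2
    rw [hμ, mul_one, pow_two, mul_assoc]
    exact mul_dvd_mul ((isCoprime_pow_sub hβ).mul_dvd d1 d2) ((isCoprime_pow_sub hα).mul_dvd d3 d4)
  · have h4 : 4 ≤ 2 * μ := by have := NeZero.ne μ; omega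
    refine Dvd.dvd.trans ?_ (pow_dvd_pow _ h4)
    rw [pow_succ, pow_succ, pow_two]
    exact mul_dvd_mul (mul_dvd_mul (mul_dvd_mul d1 d2) d3) d4

lemma exists_laurentToRat_eq (j : TorusArc (μ * p) (μ * q))
    (r : {i : TorusArc (μ * p) (μ * q) // i ≠ j} ↪ TorusCrossing (μ * p) (μ * q))
    (ρ : IrrRep (torusLinkDiagram μ p q hpq).linkGroup) :
    ∃ P, laurentToRat μ P = (torusLinkDiagram μ p q hpq).twistedAlexander ρ.1 j r := by
  obtain ⟨k, hk⟩ := exists_twistedAlexander_eq (hpq := hpq) j r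
  obtain ⟨a, b, -, -, -, ⟨hX, -⟩, hY, -⟩ := exists_core_conj ρ
  obtain ⟨Q, hQ⟩ := denominator_dvd ρ hX hY
  refine ⟨AddMonoidAlgebra.single (fun i => 2 * k i) 1 *
    Polynomial.aeval (AddMonoidAlgebra.single (fun _ => 1) 1) Q, ?_⟩
  have ht : laurentToRat μ (AddMonoidAlgebra.single (fun _ => 1) 1) = tProd μ := by
    rw [laurentToRat_single]
    simp [tProd]
  have hQ' := congrArg (Polynomial.aeval (tProd μ)) hQ
  simp only [map_mul, map_pow, map_sub, Polynomial.aeval_X, Polynomial.aeval_C, map_neg,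
    map_one] at hQ'
  have hd : ∀ (N : ℕ) [NeZero N] (z : ℂ), tProd μ ^ N - algebraMap ℂ (RatFn μ) z ≠ 0 :=
    fun N _ z => sub_ne_zero.2 (tProd_pow_ne_algebraMap N z)
  rw [hk ρ a b hX hY, map_mul, laurentToRat_single, ← Polynomial.aeval_algHom_apply, ht, hQ',
    mul_div_cancel_left₀ _ (mul_ne_zero (mul_ne_zero (mul_ne_zero (hd _ _) (hd _ _))
      (hd _ _)) (hd _ _))]

variable (μ p q hpq) in
/-- The traces at the cores. -/
def coreTraces (χ : IrrCharVariety (torusLinkDiagram μ p q hpq).linkGroup) : ℂ × ℂ :=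
  (charTrace (torusCoreX μ p q hpq) χ, charTrace (torusCoreY μ p q hpq) χ)

lemma isLocallyConstant_coreTraces : IsLocallyConstant (coreTraces μ p q hpq) := by
  refine isLocallyConstant_of_finite_range
    ((continuous_charTrace _).prodMk (continuous_charTrace _)) ?_
  refine Set.Finite.subset (((Set.finite_Iic p).image
    fun a => rootExp a p + (rootExp a p)⁻¹).prod ((Set.finite_Iic q).image
    fun b => rootExp b q + (rootExp b q)⁻¹)) ?_
  rintro _ ⟨χ, rfl⟩
  obtain ⟨ρ, rfl⟩ := Quotient.exists_rep χ
  obtain ⟨a, b, ha, hb, -, ⟨hX, -⟩, hY, -⟩ := exists_core_conj ρ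
  exact ⟨⟨a, ha, hX.symm⟩, ⟨b, hb, hY.symm⟩⟩

end Formula

end

theorem theorem4p1 (μ p q : ℕ) [NeZero μ] [NeZero p] [NeZero q] (hpq : p.Coprime q) :
    (∀ ρ : IrrRep (torusLinkDiagram μ p q hpq).linkGroup,
      ∃ a b : ℕ, a ≤ p ∧ b ≤ q ∧ a ≡ b [MOD 2] ∧
        (∃ S : SL2C, ((S * ρ.1 (torusCoreX μ p q hpq) * S⁻¹ : SL2C) : Matrix (Fin 2) (Fin 2) ℂ) =
          !![rootExp a p, 0; 0, (rootExp a p)⁻¹]) ∧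
        (∃ S : SL2C, ((S * ρ.1 (torusCoreY μ p q hpq) * S⁻¹ : SL2C) : Matrix (Fin 2) (Fin 2) ℂ) =
          !![rootExp b q, 0; 0, (rootExp b q)⁻¹])) ∧
    ∀ (j : TorusArc (μ * p) (μ * q))
      (r : {i : TorusArc (μ * p) (μ * q) // i ≠ j} ↪ TorusCrossing (μ * p) (μ * q)),
      (∃ k : Fin μ → ℤ, ∀ (ρ : IrrRep (torusLinkDiagram μ p q hpq).linkGroup) (a b : ℕ),
        a ≤ p → b ≤ q →
        Module.End.HasEigenvalue (Matrix.toLin'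
          (ρ.1 (torusCoreX μ p q hpq) : Matrix (Fin 2) (Fin 2) ℂ)) (rootExp a p) →
        Module.End.HasEigenvalue (Matrix.toLin'
          (ρ.1 (torusCoreY μ p q hpq) : Matrix (Fin 2) (Fin 2) ℂ)) (rootExp b q) →
        (torusLinkDiagram μ p q hpq).twistedAlexander ρ.1 j r =
          (∏ i, tVar i ^ (2 * k i)) *
            ((tProd μ ^ (p * q) - (-1) ^ a) ^ (2 * μ) /
              ((tProd μ ^ p - algebraMap ℂ (RatFn μ) (rootExp b q)) *
                (tProd μ ^ p - algebraMap ℂ (RatFn μ) (rootExp b q)⁻¹) *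
                (tProd μ ^ q - algebraMap ℂ (RatFn μ) (rootExp a p)) *
                (tProd μ ^ q - algebraMap ℂ (RatFn μ) (rootExp a p)⁻¹)))) ∧
      ∃ P : IrrCharVariety (torusLinkDiagram μ p q hpq).linkGroup → AddMonoidAlgebra ℂ (Fin μ → ℤ),
        (∀ ρ, laurentToRat μ (P ⟦ρ⟧) = (torusLinkDiagram μ p q hpq).twistedAlexander ρ.1 j r) ∧
        ∀ e : Fin μ → ℤ, IsLocallyConstant fun χ => (P χ).coeff e := by
  refine ⟨fun ρ => ?_, fun j r => ⟨?_, ?_⟩⟩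
  · obtain ⟨a, b, ha, hb, hab, ⟨-, hX⟩, -, hY⟩ := exists_core_conj ρ
    exact ⟨a, b, ha, hb, hab, hX, hY⟩
  · obtain ⟨k, hk⟩ := exists_twistedAlexander_eq (hpq := hpq) j r
    exact ⟨k, fun ρ a b _ _ hX hY => hk ρ a b (SL2C.ne_zero_and_trace_of_hasEigenvalue _ hX).2
      (SL2C.ne_zero_and_trace_of_hasEigenvalue _ hY).2⟩
  · -- the polynomial depends only on the traces at the cores, which are locally constant
    let F : ℂ × ℂ → AddMonoidAlgebra ℂ (Fin μ → ℤ) := fun z =>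
      open Classical in
      if h : ∃ ρ, coreTraces μ p q hpq ⟦ρ⟧ = z then
        (exists_laurentToRat_eq j r h.choose).choose else 0
    refine ⟨fun χ => F (coreTraces μ p q hpq χ), fun ρ => ?_,
      fun e => isLocallyConstant_coreTraces.comp fun z => (F z).coeff e⟩
    have h : ∃ ρ', coreTraces μ p q hpq ⟦ρ'⟧ = coreTraces μ p q hpq ⟦ρ⟧ := ⟨ρ, rfl⟩
    simp only [F, dif_pos h]
    rw [(exists_laurentToRat_eq j r h.choose).choose_spec]
    obtain ⟨k, hk⟩ := exists_twistedAlexander_eq (hpq := hpq) j r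
    obtain ⟨a, b, -, -, -, ⟨hX, -⟩, hY, -⟩ := exists_core_conj ρ
    rw [hk ρ a b hX hY]
    exact hk _ a b ((congrArg Prod.fst h.choose_spec).trans hX)
      ((congrArg Prod.snd h.choose_spec).trans hY)
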